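/- Let $\mathfrak g$ be a complex simple Lie algebra of classical type, i.e. isomorphic to some $\mathfrak{sl}(m,\mathbb C)$, $\mathfrak{so}(m,\mathbb C)$ or $\mathfrak{sp}(2m,\mathbb C)$. Let $\mathfrak g_0$ be a split real form of $\mathfrak g$: a real semisimple Lie algebra with $\mathbb C\otimes_{\mathbb R}\mathfrak g_0\cong\mathfrak g$ and with a Cartan subalgebra $\mathfrak h$ whose adjoint action on $\mathfrak g_0$ is triangularizable over $\mathbb R$. Choose a positive system $\Delta^+$ of the root system of $(\mathfrak g_0,\mathfrak h)$, and let $\mathfrak n$ be the nilradical (largest nilpotent ideal) of the minimal parabolic subalgebra $\mathfrak h\oplus\bigoplus_{\alpha\in\Delta^+}(\mathfrak g_0)_\alpha$ of $\mathfrak g_0$. Assume $\dim\mathfrak n\ge 2$. Then the following are equivalent: 1. for every $s\ge 0$ such that $\mathbb R^s\oplus\mathfrak n$ is even dimensional, the Lie algebra $\mathbb R^s\oplus\mathfrak n$ (with $\mathbb R^s$ an abelian direct summand) is symplectic, i.e. admits a closed non-degenerate skew-symmetric bilinear form; 2. $E_\infty^{0,2}(\mathfrak n)\neq 0$; 3.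 $\mathfrak g\cong\mathfrak{sl}(3,\mathbb C)$ or $\mathfrak g\cong\mathfrak{so}(5,\mathbb C)$. Here $E_\infty^{p,q}(\mathfrak n)$ is the limit term of the spectral sequence of the following filtration of the Chevalley–Eilenberg complex $(\Lambda^*\mathfrak n^*,d)$ with real coefficients. Put $V_0=0$ and $V_{i}=\{\alpha\in\mathfrak n^*: d\alpha\in\Lambda^2V_{i-1}\}$ for $i\ge 1$, let $k$ be the nilpotency index of $\mathfrak n$ (the least $k$ with $\mathfrak n^k=0$, where $\mathfrak n^0=\mathfrak n$ and $\mathfrak n^i=[\mathfrak n,\mathfrak n^{i-1}]$), and put $F^pC^i=\Lambda^iV_{k-p}$ for $0\le p<k$ and $F^pC^i=0$ for $p\ge k$. Explicitly, $$E_\infty^{p,q}(\mathfrak n)=\frac{\{x\in F^pC^{p+q}: dx=0\}}{\bigl(F^pC^{p+q}\cap d(\Lambda^{p+q-1}\mathfrak n^*)\bigr)+\{x\in F^{p+1}C^{p+q}: dx=0\}}.$$ -/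

import Mathlib

open scoped TensorProduct

noncomputable section

namespace NilSymp

/-! ### The Chevalley-Eilenberg complex of a real Lie algebra, with trivial real coefficients -/

section Complex

variable (L : Type*) [LieRing L] [LieAlgebra ℝ L]

/-- `Λ^p L^*`, identified with the space of skew-symmetric `p`-linear forms on `L`. -/
abbrev Cochain (p : ℕ) : Type _ := L [⋀^Fin p]→ₗ[ℝ] ℝ

variable {L} in
/-- `(x, y) ↦ c ([x, y], -, …, -)`. -/
def bracketContraction {p : ℕ} (c : Cochain L (p + 1)) : L →ₗ[ℝ] L →ₗ[ℝ] Cochain L p :=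
  LinearMap.mk₂ ℝ (fun x y => c.curryLeft ⁅x, y⁆)
    (fun x x' y => by simp) (fun a x y => by simp) (fun x y y' => by simp) (fun a x y => by simp)

/-- The differential `d : Λ^p L^* → Λ^(p+1) L^*`. It is zero in degree `0`. In degree `p + 1` it is
half of the full alternatization of `(x, y) ↦ c ([x, y], …)`, which is the usual sum over `i < j`,
see `ceDiff_succ_apply`. -/
def ceDiff : (p : ℕ) → Cochain L p →ₗ[ℝ] Cochain L (p + 1)
  | 0 => 0
  | p + 1 =>
    { toFun := fun c => (1 / 2 : ℝ) • AlternatingMap.alternatizeUncurryFin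
        (AlternatingMap.alternatizeUncurryFinLM ∘ₗ bracketContraction c)
      map_add' := fun c c' => by
        have h : bracketContraction (c + c') = bracketContraction c + bracketContraction c' := by
          ext; simp [bracketContraction]
        rw [h, LinearMap.comp_add, AlternatingMap.alternatizeUncurryFin_add, smul_add]
      map_smul' := fun a c => by
        have h : bracketContraction (a • c) = a • bracketContraction c := by
          ext; simp [bracketContraction]
        rw [h, LinearMap.comp_smul, AlternatingMap.alternatizeUncurryFin_smul, smul_comm]
        rfl }

variable {L}

/-- `d c (x_1, …, x_{p+2}) = ∑_{i < j} (-1)^(i+j-1) c ([x_i, x_j], x_1, …, x̂_i, …, x̂_j, …, x_{p+2})`.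
The pair `i < j` of indices in `Fin (p + 2)` is written `i.castSucc < j.succ` with `i ≤ j` in
`Fin (p + 1)`. -/
theorem ceDiff_succ_apply {p : ℕ} (c : Cochain L (p + 1)) (v : Fin (p + 2) → L) :
    ceDiff L (p + 1) c v = ∑ i : Fin (p + 1), ∑ j ≥ i, (-1 : ℝ) ^ (i + j : ℕ) *
      c (Matrix.vecCons ⁅v i.castSucc, v j.succ⁆
        (j.removeNth (i.castSucc.removeNth v : Fin (p + 1) → L))) := by
  have h : ceDiff L (p + 1) c v = (1 / 2 : ℝ) * AlternatingMap.alternatizeUncurryFin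
        (AlternatingMap.alternatizeUncurryFinLM ∘ₗ bracketContraction c) v := rfl
  rw [h, AlternatingMap.alternatizeUncurryFin_alternatizeUncurryFinLM_comp_apply, Finset.mul_sum]
  refine Finset.sum_congr rfl fun i _ => ?_
  rw [Finset.mul_sum]
  refine Finset.sum_congr rfl fun j _ => ?_
  have h2 : bracketContraction c (v j.succ) (v i.castSucc)
      = - bracketContraction c (v i.castSucc) (v j.succ) := by
    simp only [bracketContraction, LinearMap.mk₂_apply]
    rw [← lie_skew, map_neg]
  rw [h2, AlternatingMap.neg_apply, sub_neg_eq_add, zsmul_eq_mul]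
  simp only [bracketContraction, LinearMap.mk₂_apply, AlternatingMap.curryLeft_apply_apply]
  push_cast
  ring

/-- A one-form seen as a cochain of degree `1`. -/
def oneForm : Module.Dual ℝ L →ₗ[ℝ] Cochain L 1 where
  toFun α := AlternatingMap.ofSubsingleton ℝ L ℝ (0 : Fin 1) α
  map_add' _ _ := by ext; rfl
  map_smul' _ _ := by ext; rfl

/-- `α_1 ∧ … ∧ α_p`, that is `(x_1, …, x_p) ↦ det (α_a (x_b))`. -/
def wedge {p : ℕ} (α : Fin p → Module.Dual ℝ L) : Cochain L p :=
  (Matrix.detRowAlternating (R := ℝ) (n := Fin p)).compLinearMap (LinearMap.pi α)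

/-- `Λ^p V ⊆ Λ^p L^*` for a subspace `V` of `L^*`: the span of the products of elements of `V`. -/
def extPower (V : Submodule ℝ (Module.Dual ℝ L)) (p : ℕ) : Submodule ℝ (Cochain L p) :=
  Submodule.span ℝ {c | ∃ α : Fin p → Module.Dual ℝ L, (∀ a, α a ∈ V) ∧ c = wedge α}

variable (L)

/-- `V_0 = 0` and `V_{i+1} = {α ∈ L^* : dα ∈ Λ² V_i}`. -/
def filt : ℕ → Submodule ℝ (Module.Dual ℝ L)
  | 0 => ⊥
  | i + 1 => (extPower (filt i) 2).comap (ceDiff L 1 ∘ₗ oneForm)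

/-- The index `k` of a nilpotent Lie algebra: the least `k` with `L^k = 0`, where `L^0 = L` and
`L^{i+1} = [L, L^i]`. -/
def nilIndex : ℕ := LieModule.nilpotencyLength L L

/-- The degree `i` part of the `p`-th step `F^p C^*` of the decreasing filtration of the
Chevalley-Eilenberg complex: `F^p C^i = Λ^i V_{k-p}` for `p < k`, and `F^p C^* = 0` for `p ≥ k`. -/
def ceFilt (p i : ℕ) : Submodule ℝ (Cochain L i) :=
  if p < nilIndex L then extPower (filt L (nilIndex L - p)) i else ⊥

/-- The coboundaries in degree `i`. -/
def coboundaries : (i : ℕ) → Submodule ℝ (Cochain L i)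
  | 0 => ⊥
  | i + 1 => LinearMap.range (ceDiff L i)

/-- The permanent cycles `{x ∈ F^p C^i : dx = 0}`. -/
def permCycles (p i : ℕ) : Submodule ℝ (Cochain L i) :=
  ceFilt L p i ⊓ LinearMap.ker (ceDiff L i)

instance (p i : ℕ) : HasQuotient (permCycles L p i) (Submodule ℝ (permCycles L p i)) :=
  @Submodule.hasQuotient ℝ (permCycles L p i) _ (permCycles L p i).addCommGroup _

/-- `E_∞^{p,q}`, for `p, q ≥ 0`, of the spectral sequence of the filtered complex `F^p C^*`:
the quotient of `Z_∞^{p,q} = {x ∈ F^p C^{p+q} : dx = 0}` by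
`F^p C^{p+q} ∩ d(C^{p+q-1}) + {x ∈ F^{p+1} C^{p+q} : dx = 0}`. -/
abbrev EInfty (p q : ℕ) : Type _ :=
  permCycles L p (p + q) ⧸
    ((ceFilt L p (p + q) ⊓ coboundaries L (p + q)) ⊔
      permCycles L (p + 1) (p + q)).submoduleOf (permCycles L p (p + q))

/-- A symplectic Lie algebra: there is a closed non-degenerate skew-symmetric bilinear form. -/
def IsSymplectic : Prop :=
  ∃ ω : Cochain L 2, ceDiff L 2 ω = 0 ∧ ∀ x : L, (∀ y : L, ω ![x, y] = 0) → x = 0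

/-- The abelian Lie algebra `ℝ^s`. -/
def AbelianLie (s : ℕ) : Type := Fin s → ℝ

instance (s : ℕ) : AddCommGroup (AbelianLie s) := inferInstanceAs (AddCommGroup (Fin s → ℝ))

instance (s : ℕ) : Module ℝ (AbelianLie s) := inferInstanceAs (Module ℝ (Fin s → ℝ))

instance (s : ℕ) : LieRing (AbelianLie s) where
  bracket _ _ := 0
  add_lie _ _ _ := (add_zero 0).symm
  lie_add _ _ _ := (add_zero 0).symm
  lie_self _ := rfl
  leibniz_lie _ _ _ := (add_zero 0).symm

instance (s : ℕ) : LieAlgebra ℝ (AbelianLie s) where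
  lie_smul a _ _ := (smul_zero a).symm

/-- The trivial extension `ℝ^s ⊕ L` (direct sum of Lie algebras, with `ℝ^s` abelian). -/
abbrev TrivExt (s : ℕ) : Type _ := AbelianLie s × L

/-- The nilradical: the largest nilpotent ideal, as the sum of all nilpotent ideals. -/
def nilradical : LieIdeal ℝ L := sSup {I : LieIdeal ℝ L | LieRing.IsNilpotent I}

end Complex

/-! ### Minimal parabolic subalgebras of split real semisimple Lie algebras -/

section Parabolic

open LieAlgebra LieAlgebra.IsKilling

variable {g₀ : Type*} [LieRing g₀] [LieAlgebra ℝ g₀] [FiniteDimensional ℝ g₀]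
  [IsSemisimple ℝ g₀] {H : LieSubalgebra ℝ g₀} [H.IsCartanSubalgebra]
  [LieModule.IsTriangularizable ℝ H g₀]

/-- The minimal parabolic subalgebra `𝔥 ⊕ ⨁_{α > 0} 𝔤_α` of a split real semisimple Lie algebra,
for a split Cartan subalgebra `H = 𝔥` and the positive system with base `b`. -/
def minimalParabolic (b : (rootSystem H).Base) : LieSubalgebra ℝ g₀ where
  __ := H.toSubmodule ⊔ ⨆ α : {α : H.root // b.IsPos α}, (rootSpace H α.1.1).toSubmodule
  lie_mem' := by
    have hroot : ∀ (α β : {α : H.root // b.IsPos α}) (x y : g₀), x ∈ rootSpace H α.1.1 →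
        y ∈ rootSpace H β.1.1 →
        ⁅x, y⁆ ∈ ⨆ α : {α : H.root // b.IsPos α}, (rootSpace H α.1.1).toSubmodule := by
      intro α β x y hx hy
      have hxy : ⁅x, y⁆ ∈ rootSpace H ((α.1.1 : H → ℝ) + β.1.1) :=
        lie_mem_genWeightSpace_of_mem_genWeightSpace hx hy
      by_cases hbot : rootSpace H ((α.1.1 : H → ℝ) + β.1.1) = ⊥
      · rw [hbot] at hxy
        rw [(LieSubmodule.mem_bot _).mp hxy]
        exact zero_mem _
      · let γ : LieModule.Weight ℝ H g₀ := ⟨(α.1.1 : H → ℝ) + β.1.1, hbot⟩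
        have hγ : γ.IsNonZero := by
          intro h0
          have h0' : ((α.1.1 : H → ℝ) + β.1.1) = 0 := h0
          let _ := (rootSystem H).indexNeg
          have hneg : β.1 = -α.1 := by
            apply (rootSystem H).root.injective
            ext h
            have := congrFun h0' h
            simp only [Pi.add_apply, Pi.zero_apply] at this
            simp only [RootPairing.indexNeg_neg, RootPairing.root_reflectionPerm,
              RootPairing.reflection_apply_self, LinearMap.neg_apply]
            exact eq_neg_of_add_eq_zero_right this
          exact (RootPairing.Base.IsPos.neg_iff_not b α.1).mp (hneg ▸ β.2) α.2
        have hγ' : γ ∈ H.root := by simpa using hγ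
        have hpos : b.IsPos ⟨γ, hγ'⟩ := by
          refine RootPairing.Base.IsPos.add α.2 β.2 ?_
          ext h
          rfl
        exact Submodule.mem_iSup_of_mem (p := fun α : {α : H.root // b.IsPos α} =>
          (rootSpace H α.1.1).toSubmodule) ⟨⟨γ, hγ'⟩, hpos⟩ hxy
    have hHS : ∀ h ∈ H,
        ∀ y ∈ ⨆ α : {α : H.root // b.IsPos α}, (rootSpace H α.1.1).toSubmodule,
        ⁅h, y⁆ ∈ ⨆ α : {α : H.root // b.IsPos α}, (rootSpace H α.1.1).toSubmodule := by
      intro h hh y hy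
      induction hy using Submodule.iSup_induction' with
      | mem α y hy =>
        exact Submodule.mem_iSup_of_mem (p := fun α : {α : H.root // b.IsPos α} =>
          (rootSpace H α.1.1).toSubmodule) α ((rootSpace H α.1.1).lie_mem (x := ⟨h, hh⟩) hy)
      | zero => simp
      | add y z _ _ hy hz => rw [lie_add]; exact add_mem hy hz
    have hSS : ∀ x ∈ ⨆ α : {α : H.root // b.IsPos α}, (rootSpace H α.1.1).toSubmodule,
        ∀ y ∈ ⨆ α : {α : H.root // b.IsPos α}, (rootSpace H α.1.1).toSubmodule,
        ⁅x, y⁆ ∈ ⨆ α : {α : H.root // b.IsPos α}, (rootSpace H α.1.1).toSubmodule := by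
      intro x hx y hy
      induction hx using Submodule.iSup_induction' with
      | mem α x hx =>
        induction hy using Submodule.iSup_induction' with
        | mem β y hy => exact hroot α β x y hx hy
        | zero => simp
        | add y z _ _ hy hz => rw [lie_add]; exact add_mem hy hz
      | zero => simp
      | add y z _ _ hy hz => rw [add_lie]; exact add_mem hy hz
    intro x y hx hy
    obtain ⟨h, hh, u, hu, rfl⟩ := Submodule.mem_sup.mp hx
    obtain ⟨h', hh', u', hu', rfl⟩ := Submodule.mem_sup.mp hy
    rw [add_lie, lie_add, lie_add]
    refine add_mem (add_mem (Submodule.mem_sup_left (H.lie_mem hh hh'))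
      (Submodule.mem_sup_right (hHS h hh u' hu'))) (add_mem ?_
      (Submodule.mem_sup_right (hSS u hu u' hu')))
    rw [← lie_skew]
    exact neg_mem (Submodule.mem_sup_right (hHS h' hh' u hu))

end Parabolic

/-- A complex Lie algebra of classical type: isomorphic to some `𝔰𝔩(m,ℂ)`, `𝔰𝔬(m,ℂ)` or
`𝔰𝔭(2m,ℂ)`. -/
def IsClassical (g : Type*) [LieRing g] [LieAlgebra ℂ g] : Prop :=
  ∃ m : ℕ, Nonempty (g ≃ₗ⁅ℂ⁆ LieAlgebra.SpecialLinear.sl (Fin m) ℂ) ∨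
    Nonempty (g ≃ₗ⁅ℂ⁆ LieAlgebra.Orthogonal.so (Fin m) ℂ) ∨
    Nonempty (g ≃ₗ⁅ℂ⁆ LieAlgebra.Symplectic.sp (Fin m) ℂ)

end NilSymp

end

/-! The whole spectral sequence reduces to one condition on 𝔫. The space V_i is the annihilator of
𝔫^i, so F^1 in degree two consists of the forms whose radical contains the last nonzero term of the
lower central series. That term is central, so coboundaries lie in F^1. Hence E_∞^{0,2} ≠ 0 means
that some closed ω has ω(z, y) ≠ 0 with z in that term (`nontrivial_eInfty_iff`). A symplectic form
on ℝ^s ⊕ 𝔫 restricts to such an ω, because closedness makes [𝔫, 𝔫] orthogonal to ℝ^s.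

Suppose such an ω exists. The center of 𝔫 is stable under the Cartan subalgebra, so z may be
replaced by a root vector of some root θ with no θ + β a root for β > 0, and y by a root vector e_γ.
Let S be the set of roots β with ⟨β, θ^∨⟩ = 1. The involution β ↦ θ - β acts on S, and the root
vectors of S span a Heisenberg space V: brackets land in the line of e_θ and are non-degenerate
there. Every positive γ is θ, lies in S, or is orthogonal to θ. The first is impossible by
skew-symmetry. If γ ∈ S, closedness forces dim V ≤ 2 (`finrank_le_two_of_heisenberg`). If γ is
orthogonal to θ, closedness exhibits the identity of V as a commutator, so V = 0 by taking traces
(`eq_bot_of_heisenberg`). Thus |S| ≤ 2.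

The rest is counting. Irreducibility and dim 𝔫 ≥ 2 give |S| = 2; then the rank is 2, at most one
positive root is orthogonal to θ, and dim 𝔤 is 8 or 10. Among classical algebras only sl(3), so(5)
and sp(4) ≅ so(5) have these dimensions. Conversely, those dimensions force |S| = 2, so 𝔫 is the
three-dimensional Heisenberg algebra or the four-dimensional filiform algebra, and explicit
symplectic forms exist on their even-dimensional trivial extensions. -/

noncomputable section

namespace NilSymp

section Complex

variable {L : Type*} [LieRing L] [LieAlgebra ℝ L]

/-! ### Two-forms -/

/-- The two-form attached to an alternating bilinear form. -/
def twoForm (B : L →ₗ[ℝ] L →ₗ[ℝ] ℝ) (hB : ∀ x, B x x = 0) : Cochain L 2 where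
  toFun v := B (v 0) (v 1)
  map_update_add' v i x y := by
    fin_cases i <;> simp [Function.update]
  map_update_smul' v i a x := by
    fin_cases i <;> simp [Function.update]
  map_eq_zero_of_eq' v i j h hij := by
    have : v 0 = v 1 := by fin_cases i <;> fin_cases j <;> simp_all
    rw [this, hB]

@[simp] theorem twoForm_apply (B : L →ₗ[ℝ] L →ₗ[ℝ] ℝ) (hB : ∀ x, B x x = 0) (v : Fin 2 → L) :
    twoForm B hB v = B (v 0) (v 1) := rfl

/-- The bilinear form attached to a two-form. -/
def toBilin (ω : Cochain L 2) : L →ₗ[ℝ] L →ₗ[ℝ] ℝ :=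
  LinearMap.mk₂ ℝ (fun x y => ω ![x, y])
    (fun x x' y => ω.map_vecCons_add ![y] x x')
    (fun a x y => ω.map_vecCons_smul ![y] a x)
    (fun x y y' => by
      have h1 := ω.map_update_add ![x, y] 1 y y'
      have h2 : ∀ w, Function.update ![x, y] 1 w = ![x, w] := fun w => by
        ext i; fin_cases i <;> simp
      simpa only [h2] using h1)
    (fun a x y => by
      have h1 := ω.map_update_smul ![x, y] 1 a y
      have h2 : ∀ w, Function.update ![x, y] 1 w = ![x, w] := fun w => by
        ext i; fin_cases i <;> simp
      simpa only [h2] using h1)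

@[simp] theorem toBilin_apply (ω : Cochain L 2) (x y : L) : toBilin ω x y = ω ![x, y] := rfl

theorem toBilin_self (ω : Cochain L 2) (x : L) : toBilin ω x x = 0 :=
  ω.map_eq_zero_of_eq ![x, x] (i := 0) (j := 1) rfl (by decide)

theorem toBilin_swap (ω : Cochain L 2) (x y : L) : toBilin ω x y = - toBilin ω y x := by
  have h := toBilin_self ω (x + y)
  simp only [map_add, LinearMap.add_apply, toBilin_self] at h
  linarith

theorem ext_two {ω η : Cochain L 2} (h : ∀ x y, ω ![x, y] = η ![x, y]) : ω = η := by
  ext v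
  have : v = ![v 0, v 1] := by ext i; fin_cases i <;> rfl
  rw [this, h]

theorem ceDiff_two_apply (ω : Cochain L 2) (v : Fin 3 → L) :
    ceDiff L 2 ω v = toBilin ω ⁅v 0, v 1⁆ (v 2) - toBilin ω ⁅v 0, v 2⁆ (v 1)
      + toBilin ω ⁅v 1, v 2⁆ (v 0) := by
  rw [ceDiff_succ_apply]
  have h0 : ∀ x : L, ∀ w : Fin 1 → L, ω (Matrix.vecCons x w) = toBilin ω x (w 0) := fun x w => by
    rw [toBilin_apply]
    congr 1
    ext i; fin_cases i <;> rfl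
  have e1 : Finset.Ici (0 : Fin 2) = {0, 1} := by decide
  have e2 : Finset.Ici (1 : Fin 2) = {1} := by decide
  have e3 : Fin.removeNth (0 : Fin 2) (Fin.removeNth (0 : Fin 3) v) 0 = v 2 := rfl
  have e4 : Fin.removeNth (1 : Fin 2) (Fin.removeNth (0 : Fin 3) v) 0 = v 1 := rfl
  have e5 : Fin.removeNth (1 : Fin 2) (Fin.removeNth (1 : Fin 3) v) 0 = v 0 := rfl
  simp only [h0]
  refine (Fin.sum_univ_two (M := ℝ) _).trans ?_
  rw [e1, e2, Finset.sum_pair (by decide), Finset.sum_singleton]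
  simp only [Fin.castSucc_zero, Fin.succ_zero_eq_one, Fin.castSucc_one, Fin.succ_one_eq_two,
    e3, e4, e5]
  norm_num
  ring

theorem ceDiff_two_eq_zero_iff (ω : Cochain L 2) :
    ceDiff L 2 ω = 0 ↔ ∀ x y z, toBilin ω ⁅x, y⁆ z + toBilin ω ⁅y, z⁆ x
      + toBilin ω ⁅z, x⁆ y = 0 := by
  constructor
  · intro h x y z
    have := congrArg (fun c => c ![x, y, z]) h
    simp only [ceDiff_two_apply, AlternatingMap.zero_apply] at this
    rw [← lie_skew z x, map_neg, LinearMap.neg_apply]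
    simp at this ⊢
    linarith
  · intro h
    ext v
    rw [ceDiff_two_apply, ← lie_skew (v 0) (v 2), map_neg, LinearMap.neg_apply]
    have := h (v 0) (v 1) (v 2)
    simp only [AlternatingMap.zero_apply]
    linarith

/-- The sign is opposite to the frequent convention dα(x, y) = -α([x, y]); kernels and images are
unaffected. -/
theorem ceDiff_oneForm_apply (α : Module.Dual ℝ L) (x y : L) :
    ceDiff L 1 (oneForm α) ![x, y] = α ⁅x, y⁆ := by
  rw [ceDiff_succ_apply]
  simp [oneForm]

theorem exists_oneForm (c : Cochain L 1) : ∃ α, oneForm α = c := by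
  refine ⟨(AlternatingMap.ofSubsingleton ℝ L ℝ (0 : Fin 1)).symm c, ?_⟩
  exact (AlternatingMap.ofSubsingleton ℝ L ℝ (0 : Fin 1)).apply_symm_apply c

theorem wedge_two_apply (α : Fin 2 → Module.Dual ℝ L) (x y : L) :
    wedge α ![x, y] = α 0 x * α 1 y - α 0 y * α 1 x := by
  have : wedge α ![x, y] = Matrix.det (Matrix.of fun i j => α j (![x, y] i)) := rfl
  rw [this, Matrix.det_fin_two]
  simp [mul_comm]

theorem sum_cochain_apply {ι : Type*} (s : Finset ι) {p : ℕ} (c : ι → Cochain L p)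
    (v : Fin p → L) : (∑ i ∈ s, c i) v = ∑ i ∈ s, c i v :=
  map_sum (⟨⟨fun c : Cochain L p => c v, rfl⟩, fun _ _ => rfl⟩ : Cochain L p →+ ℝ) c s

/-- `Λ² U^⊥` consists of the two-forms whose radical contains `U`. -/
theorem mem_extPower_dualAnnihilator_two [FiniteDimensional ℝ L] (U : Submodule ℝ L)
    (ω : Cochain L 2) :
    ω ∈ extPower U.dualAnnihilator 2 ↔ ∀ x ∈ U, ∀ y, ω ![x, y] = 0 := by
  constructor
  · intro h x hx y
    induction h using Submodule.span_induction with
    | mem c hc =>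
      obtain ⟨α, hα, rfl⟩ := hc
      have h0 := (Submodule.mem_dualAnnihilator _).mp (hα 0) x hx
      have h1 := (Submodule.mem_dualAnnihilator _).mp (hα 1) x hx
      rw [wedge_two_apply, h0, h1]; ring
    | zero => rfl
    | add c c' _ _ h h' => rw [AlternatingMap.add_apply, h, h', add_zero]
    | smul a c _ h => rw [AlternatingMap.smul_apply, h, smul_zero]
  · intro h
    -- A linear section s of L → L/U gives a projection P with kernel U. Since U lies in the
    -- radical, ω(x, y) = ω(Px, Py).
    obtain ⟨s, hs⟩ := U.mkQ.exists_rightInverse_of_surjective U.range_mkQ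
    have hP : ∀ x, x - s (U.mkQ x) ∈ U := fun x => by
      rw [← Submodule.Quotient.mk_eq_zero, ← Submodule.mkQ_apply, map_sub, sub_eq_zero]
      exact (LinearMap.congr_fun hs (U.mkQ x)).symm
    set P := s ∘ₗ U.mkQ with hPdef
    have hP0 : ∀ x ∈ U, P x = 0 := fun x hx => by
      have : U.mkQ x = 0 := by rwa [← LinearMap.mem_ker, U.ker_mkQ]
      simp [hPdef, this]
    let b := Module.finBasis ℝ L
    let α := fun i => b.coord i ∘ₗ P
    have hα : ∀ i, α i ∈ U.dualAnnihilator := fun i =>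
      (Submodule.mem_dualAnnihilator _).mpr fun x hx => by simp [α, hP0 x hx]
    -- The factor 1/2 appears because (i, j) and (j, i) contribute the same term.
    have key : ω = ∑ i, ∑ j, ((1 / 2 : ℝ) * ω ![b i, b j]) • wedge ![α i, α j] := by
      apply ext_two
      intro x y
      have e1 : toBilin ω x y = toBilin ω (P x) (P y) := by
        have hx := h _ (hP x) y
        have hy := h _ (hP y) (P x)
        change toBilin ω (x - P x) y = 0 at hx
        change toBilin ω (y - P y) (P x) = 0 at hy
        rw [map_sub, LinearMap.sub_apply] at hx
        rw [toBilin_swap, map_sub] at hy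
        linarith
      have e2 : toBilin ω (P x) (P y) = ∑ i, ∑ j, α i x * α j y * toBilin ω (b i) (b j) := by
        conv_lhs => rw [← b.sum_repr (P x), ← b.sum_repr (P y)]
        simp only [map_sum, LinearMap.sum_apply, map_smul, LinearMap.smul_apply, smul_eq_mul]
        rw [Finset.sum_comm]
        refine Finset.sum_congr rfl fun i _ => ?_
        rw [Finset.mul_sum]
        refine Finset.sum_congr rfl fun j _ => ?_
        simp only [α, LinearMap.comp_apply, Module.Basis.coord_apply]
        ring
      have e3 : ∑ i, ∑ j, α i x * α j y * toBilin ω (b i) (b j)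
          = - ∑ i, ∑ j, α j x * α i y * toBilin ω (b i) (b j) := by
        rw [Finset.sum_comm, ← Finset.sum_neg_distrib]
        refine Finset.sum_congr rfl fun i _ => ?_
        rw [← Finset.sum_neg_distrib]
        refine Finset.sum_congr rfl fun j _ => ?_
        rw [toBilin_swap]; ring
      rw [← toBilin_apply, e1, e2]
      have e4 : (∑ i, ∑ j, ((1 / 2 : ℝ) * ω ![b i, b j]) • wedge ![α i, α j]) ![x, y]
          = (1 / 2 : ℝ) * (∑ i, ∑ j, α i x * α j y * toBilin ω (b i) (b j)
            - ∑ i, ∑ j, α j x * α i y * toBilin ω (b i) (b j)) := by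
        rw [← Finset.sum_sub_distrib, Finset.mul_sum, sum_cochain_apply]
        refine Finset.sum_congr rfl fun i _ => ?_
        rw [← Finset.sum_sub_distrib, Finset.mul_sum, sum_cochain_apply]
        refine Finset.sum_congr rfl fun j _ => ?_
        rw [AlternatingMap.smul_apply, wedge_two_apply, smul_eq_mul, toBilin_apply]
        simp only [Matrix.cons_val_zero, Matrix.cons_val_one]
        ring
      rw [e4]
      linarith
    rw [key]
    refine Submodule.sum_mem _ fun i _ => Submodule.sum_mem _ fun j _ =>
      Submodule.smul_mem _ _ (Submodule.subset_span ⟨_, fun a => ?_, rfl⟩)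
    fin_cases a
    · exact hα i
    · exact hα j

/-! ### The filtration and the term E_∞^{0,2} -/

variable (L) in
/-- The subspaces `V_i` are the annihilators of the terms of the lower central series. -/
theorem filt_eq_dualAnnihilator [FiniteDimensional ℝ L] (i : ℕ) :
    filt L i = (LieModule.lowerCentralSeries ℝ L L i).toSubmodule.dualAnnihilator := by
  induction i with
  | zero => simp [filt]
  | succ i ih =>
    ext α
    -- By induction Λ²V_i is the space of forms with L^i in the radical, and dα is such a form
    -- exactly when α kills [L, L^i].
    rw [filt, ih, Submodule.mem_comap, mem_extPower_dualAnnihilator_two,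
      LieModule.lowerCentralSeries_succ, LieSubmodule.lieIdeal_oper_eq_linear_span',
      Submodule.mem_dualAnnihilator]
    simp only [LinearMap.comp_apply, ceDiff_oneForm_apply]
    constructor
    · intro h w hw
      induction hw using Submodule.span_induction with
      | mem c hc =>
        obtain ⟨x, -, n, hn, rfl⟩ := hc
        rw [← lie_skew, map_neg, h n hn x, neg_zero]
      | zero => simp
      | add c c' _ _ h h' => rw [map_add, h, h', add_zero]
      | smul a c _ h => rw [map_smul, h, smul_zero]
    · intro h x hx y
      rw [← lie_skew, map_neg, h _ (Submodule.subset_span ⟨y, trivial, x, hx, rfl⟩), neg_zero]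

/-- One more bracket lands in the zero term. Writing the index as k + 2 says that L is not abelian:
the last nonzero term has number k + 1 ≥ 1 and so lies in [L, L]. -/
theorem lie_eq_zero_of_mem_lcs {k : ℕ} (hk : nilIndex L = k + 2) [LieRing.IsNilpotent L] {z : L}
    (hz : z ∈ LieModule.lowerCentralSeries ℝ L L (k + 1)) (x : L) : ⁅z, x⁆ = 0 := by
  obtain ⟨h, -⟩ := (LieModule.nilpotencyLength_eq_succ_iff ℝ L L (k + 1)).mp hk
  have : ⁅x, z⁆ ∈ LieModule.lowerCentralSeries ℝ L L (k + 2) := by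
    rw [LieModule.lowerCentralSeries_succ]
    exact LieSubmodule.lie_mem_lie (LieSubmodule.mem_top x) hz
  rw [h, LieSubmodule.mem_bot] at this
  rw [← lie_skew, this, neg_zero]

theorem mem_permCycles_zero_two [FiniteDimensional ℝ L] [LieRing.IsNilpotent L] {k : ℕ}
    (hk : nilIndex L = k + 2) (ω : Cochain L 2) : ω ∈ permCycles L 0 2 ↔ ceDiff L 2 ω = 0 := by
  obtain ⟨h, -⟩ := (LieModule.nilpotencyLength_eq_succ_iff ℝ L L (k + 1)).mp hk
  have : ω ∈ ceFilt L 0 2 := by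
    rw [ceFilt, if_pos (by omega), filt_eq_dualAnnihilator, mem_extPower_dualAnnihilator_two]
    intro x hx y
    rw [Nat.sub_zero, hk, h] at hx
    have : x = 0 := by simpa using hx
    rw [this, ← toBilin_apply, map_zero, LinearMap.zero_apply]
  rw [permCycles, Submodule.mem_inf, LinearMap.mem_ker]
  exact ⟨fun h => h.2, fun h => ⟨this, h⟩⟩

theorem mem_ceFilt_one_two [FiniteDimensional ℝ L] {k : ℕ}
    (hk : nilIndex L = k + 2) (ω : Cochain L 2) : ω ∈ ceFilt L 1 2 ↔
      ∀ z ∈ LieModule.lowerCentralSeries ℝ L L (k + 1), ∀ y, ω ![z, y] = 0 := by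
  rw [ceFilt, if_pos (by omega), filt_eq_dualAnnihilator, mem_extPower_dualAnnihilator_two, hk,
    show k + 2 - 1 = k + 1 by omega]
  simp only [LieSubmodule.mem_toSubmodule]

/-- A coboundary dα vanishes on central elements and therefore already lies in F^1, so on closed
forms the denominator of E_∞^{0,2} is just F^1. -/
theorem mem_sup_permCycles_one_two [FiniteDimensional ℝ L] [LieRing.IsNilpotent L] {k : ℕ}
    (hk : nilIndex L = k + 2) {ω : Cochain L 2} (hω : ceDiff L 2 ω = 0) :
    ω ∈ (ceFilt L 0 2 ⊓ coboundaries L 2) ⊔ permCycles L 1 2 ↔ ω ∈ ceFilt L 1 2 := by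
  constructor
  · intro h
    refine (sup_le ?_ inf_le_left : _ ≤ ceFilt L 1 2) h
    rintro c ⟨-, η, rfl⟩
    obtain ⟨α, rfl⟩ := exists_oneForm η
    rw [mem_ceFilt_one_two hk]
    intro z hz y
    rw [ceDiff_oneForm_apply, lie_eq_zero_of_mem_lcs hk hz, map_zero]
  · intro h
    exact Submodule.mem_sup_right ⟨h, hω⟩

theorem nontrivial_eInfty_iff_not_le (p q : ℕ) :
    Nontrivial (EInfty L p q) ↔ ¬ permCycles L p (p + q) ≤
      (ceFilt L p (p + q) ⊓ coboundaries L (p + q)) ⊔ permCycles L (p + 1) (p + q) := by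
  rw [← Submodule.submoduleOf_eq_top]
  exact Submodule.Quotient.nontrivial_iff

theorem nontrivial_eInfty_iff [FiniteDimensional ℝ L] [LieRing.IsNilpotent L] {k : ℕ}
    (hk : nilIndex L = k + 2) :
    Nontrivial (EInfty L 0 2) ↔ ∃ ω : Cochain L 2, ceDiff L 2 ω = 0 ∧
      ∃ z ∈ LieModule.lowerCentralSeries ℝ L L (k + 1), ∃ y, ω ![z, y] ≠ 0 := by
  refine (nontrivial_eInfty_iff_not_le 0 2).trans ?_
  simp only [Nat.zero_add]
  rw [SetLike.not_le_iff_exists]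
  constructor
  · rintro ⟨ω, hω, hn⟩
    have hc := (mem_permCycles_zero_two hk ω).mp hω
    rw [mem_sup_permCycles_one_two hk hc, mem_ceFilt_one_two hk] at hn
    push Not at hn
    exact ⟨ω, hc, hn⟩
  · rintro ⟨ω, hc, z, hz, y, hy⟩
    refine ⟨ω, (mem_permCycles_zero_two hk ω).mpr hc, ?_⟩
    rw [mem_sup_permCycles_one_two hk hc, mem_ceFilt_one_two hk]
    exact fun h => hy (h z hz y)

end Complex

/-! ### Symplectic forms on trivial extensions -/

section Symplectic

variable {L : Type*} [LieRing L] [LieAlgebra ℝ L]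

theorem ceDiff_two_compLinearMap {L' : Type*} [LieRing L'] [LieAlgebra ℝ L'] (f : L →ₗ⁅ℝ⁆ L')
    {ω : Cochain L' 2} (h : ceDiff L' 2 ω = 0) :
    ceDiff L 2 (ω.compLinearMap (f : L →ₗ[ℝ] L')) = 0 := by
  have h1 : ∀ x y, toBilin (ω.compLinearMap (f : L →ₗ[ℝ] L')) x y = toBilin ω (f x) (f y) :=
    fun x y => by
      simp only [toBilin_apply, AlternatingMap.compLinearMap_apply]
      congr 1
      ext i
      fin_cases i <;> rfl
  rw [ceDiff_two_eq_zero_iff] at h ⊢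
  intro x y z
  simp only [h1, LieHom.map_lie, h]

/-- A symplectic form on a trivial extension restricts to a closed two-form whose radical does not
contain the last term of the lower central series. -/
theorem exists_closed_of_isSymplectic_trivExt [LieRing.IsNilpotent L] {k s : ℕ}
    (hk : nilIndex L = k + 2) (hs : IsSymplectic (TrivExt L s)) :
    ∃ ω : Cochain L 2, ceDiff L 2 ω = 0 ∧
      ∃ z ∈ LieModule.lowerCentralSeries ℝ L L (k + 1), ∃ y, ω ![z, y] ≠ 0 := by
  obtain ⟨ω, hω, hn⟩ := hs
  obtain ⟨-, h⟩ := (LieModule.nilpotencyLength_eq_succ_iff ℝ L L (k + 1)).mp hk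
  obtain ⟨z, hz, hz0⟩ := (Submodule.ne_bot_iff _).mp ((LieSubmodule.toSubmodule_eq_bot _).not.mpr h)
  -- Closedness on (a, b, t), with t central, leaves only ω([a, b], t) = 0, and z is a sum of
  -- brackets since k + 1 is a successor.
  have key : ∀ t : AbelianLie s, toBilin ω (0, z) (t, 0) = 0 := by
    intro t
    rw [LieModule.lowerCentralSeries_succ,
      LieSubmodule.lieIdeal_oper_eq_linear_span'] at hz
    clear hz0
    induction hz using Submodule.span_induction with
    | mem c hc =>
      obtain ⟨a, -, b, -, rfl⟩ := hc
      have := (ceDiff_two_eq_zero_iff ω).mp hω (0, a) (0, b) (t, 0)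
      have e1 : ⁅((0 : AbelianLie s), a), ((0 : AbelianLie s), b)⁆ = (0, ⁅a, b⁆) := by
        ext1 <;> simp
      have e2 : ⁅((0 : AbelianLie s), b), ((t : AbelianLie s), (0 : L))⁆ = 0 := by ext1 <;> simp
      have e3 : ⁅((t : AbelianLie s), (0 : L)), ((0 : AbelianLie s), a)⁆ = 0 := by ext1 <;> simp
      rw [e1, e2, e3] at this
      simpa using this
    | zero => exact LinearMap.congr_fun (map_zero (toBilin ω)) _
    | add a b _ _ ha hb =>
      have : ((0 : AbelianLie s), a + b) = (0, a) + (0, b) := by simp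
      rw [this, map_add, LinearMap.add_apply, ha, hb, add_zero]
    | smul r a _ ha =>
      have : ((0 : AbelianLie s), r • a) = r • (0, a) := by simp
      rw [this, map_smul, LinearMap.smul_apply, ha, smul_zero]
  let f : L →ₗ⁅ℝ⁆ TrivExt L s :=
    { LinearMap.inr ℝ (AbelianLie s) L with
      map_lie' := fun {x y} => by ext1 <;> simp }
  refine ⟨ω.compLinearMap (f : L →ₗ[ℝ] TrivExt L s), ceDiff_two_compLinearMap f hω, z, hz, ?_⟩
  by_contra! hc
  apply hz0
  have hf : ∀ y, toBilin ω (0, z) (0, y) = 0 := fun y => by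
    rw [← hc y, AlternatingMap.compLinearMap_apply, toBilin_apply]
    congr 1
    ext i : 1
    fin_cases i <;> rfl
  have := hn (0, z) (fun w => by
    rw [← toBilin_apply]
    have e : w = (w.1, 0) + (0, w.2) := by simp
    rw [e, map_add, key, hf, add_zero])
  exact congrArg Prod.snd this

theorem exists_nondegenerate_alternating (V : Type*) [AddCommGroup V] [Module ℝ V]
    [FiniteDimensional ℝ V] (h : Even (Module.finrank ℝ V)) :
    ∃ B : V →ₗ[ℝ] V →ₗ[ℝ] ℝ, (∀ x, B x x = 0) ∧ ∀ x, (∀ y, B x y = 0) → x = 0 := by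
  obtain ⟨m, hm⟩ := h
  have e : V ≃ₗ[ℝ] (Fin m → ℝ) × (Fin m → ℝ) := LinearEquiv.ofFinrankEq _ _ (by simp [hm])
  let B₀ : (Fin m → ℝ) × (Fin m → ℝ) →ₗ[ℝ] (Fin m → ℝ) × (Fin m → ℝ) →ₗ[ℝ] ℝ :=
    LinearMap.mk₂ ℝ (fun a b => a.1 ⬝ᵥ b.2 - a.2 ⬝ᵥ b.1)
      (fun a a' b => by simp; ring) (fun c a b => by simp; ring)
      (fun a b b' => by simp; ring) (fun c a b => by simp; ring)
  refine ⟨B₀.compl₁₂ e e, fun x => ?_, fun x hx => ?_⟩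
  · simp [B₀, dotProduct_comm]
  · have hx' : ∀ y, B₀ (e x) y = 0 := fun y => by simpa using hx (e.symm y)
    have h1 : (e x).1 = 0 := by
      ext i
      simpa [B₀] using hx' (0, Pi.single i 1)
    have h2 : (e x).2 = 0 := by
      ext i
      simpa [B₀] using hx' (Pi.single i 1, 0)
    exact e.map_eq_zero_iff.mp (Prod.ext h1 h2)

instance (s : ℕ) : FiniteDimensional ℝ (AbelianLie s) :=
  inferInstanceAs (FiniteDimensional ℝ (Fin s → ℝ))

theorem finrank_abelianLie (s : ℕ) : Module.finrank ℝ (AbelianLie s) = s :=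
  Module.finrank_fin_fun ℝ

theorem isSymplectic_of_bilin (B : L →ₗ[ℝ] L →ₗ[ℝ] ℝ) (hB : ∀ x, B x x = 0)
    (hd : ∀ x y z, B ⁅x, y⁆ z + B ⁅y, z⁆ x + B ⁅z, x⁆ y = 0)
    (hn : ∀ x, (∀ y, B x y = 0) → x = 0) : IsSymplectic L := by
  refine ⟨twoForm B hB, ?_, fun x hx => hn x fun y => by simpa using hx y⟩
  rw [ceDiff_two_eq_zero_iff]
  intro x y z
  simpa using hd x y z

/-- `X ∧ Y` as a bilinear form. -/
def wedgeBilin (X Y : Module.Dual ℝ L) : L →ₗ[ℝ] L →ₗ[ℝ] ℝ :=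
  LinearMap.mk₂ ℝ (fun a b => X a * Y b - Y a * X b)
    (fun a a' b => by simp; ring) (fun c a b => by simp; ring)
    (fun a b b' => by simp; ring) (fun c a b => by simp; ring)

@[simp] theorem wedgeBilin_apply (X Y : Module.Dual ℝ L) (a b : L) :
    wedgeBilin X Y a b = X a * Y b - Y a * X b := rfl

/-- Trivial extensions of the three-dimensional Heisenberg algebra. -/
theorem isSymplectic_trivExt_of_heisenberg {X Y Z : Module.Dual ℝ L} {x y z : L}
    (hX : ∀ a b : L, X ⁅a, b⁆ = 0) (hY : ∀ a b : L, Y ⁅a, b⁆ = 0)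
    (hZ : ∀ a b : L, Z ⁅a, b⁆ = X a * Y b - X b * Y a)
    (hx : X x = 1 ∧ Y x = 0 ∧ Z x = 0) (hy : X y = 0 ∧ Y y = 1 ∧ Z y = 0)
    (hz : X z = 0 ∧ Y z = 0 ∧ Z z = 1)
    (hsep : ∀ a, X a = 0 → Y a = 0 → Z a = 0 → a = 0) {s : ℕ} (hs : Odd s) :
    IsSymplectic (TrivExt L s) := by
  -- The extra copy of ℝ receives the coordinate Y, which is left unpaired by X ∧ Z; s + 1 is even.
  obtain ⟨η, hη, hηn⟩ := exists_nondegenerate_alternating (AbelianLie s × ℝ)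
    (by rw [Module.finrank_prod, finrank_abelianLie, Module.finrank_self]; exact hs.add_one)
  let p : TrivExt L s →ₗ[ℝ] AbelianLie s × ℝ := LinearMap.prodMap LinearMap.id Y
  have hp : ∀ a b : TrivExt L s, p ⁅a, b⁆ = 0 := fun a b => by
    ext1
    · rfl
    · exact hY _ _
  let X' : Module.Dual ℝ (TrivExt L s) := X ∘ₗ LinearMap.snd ℝ _ _
  let Z' : Module.Dual ℝ (TrivExt L s) := Z ∘ₗ LinearMap.snd ℝ _ _
  have hX' : ∀ a b : TrivExt L s, X' ⁅a, b⁆ = 0 := fun a b => hX _ _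
  have hZ' : ∀ a b : TrivExt L s, Z' ⁅a, b⁆ = X a.2 * Y b.2 - X b.2 * Y a.2 := fun a b => hZ _ _
  -- The pullback of η is closed because p kills brackets, and X ∧ Z is closed because dX = 0 and dZ
  -- = X ∧ Y.
  refine isSymplectic_of_bilin (η.compl₁₂ p p + wedgeBilin X' Z') (fun a => ?_) (fun a b c => ?_)
    (fun a ha => ?_)
  · simp only [LinearMap.add_apply, LinearMap.compl₁₂_apply, hη, wedgeBilin_apply]
    ring
  · simp only [LinearMap.add_apply, LinearMap.compl₁₂_apply, hp, map_zero, wedgeBilin_apply,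
      LinearMap.zero_apply, hX', hZ']
    simp only [X', LinearMap.comp_apply, LinearMap.snd_apply]
    ring
  · simp only [LinearMap.add_apply, LinearMap.compl₁₂_apply, wedgeBilin_apply] at ha
    have h0 : ∀ w, η w (0, 0) = 0 := fun w => map_zero (η w)
    have h1 : X a.2 = 0 := by simpa [p, X', Z', hz, h0] using ha (0, z)
    have h2 : Z a.2 = 0 := by simpa [p, X', Z', hx, h0] using ha (0, x)
    have h3 : p a = 0 := by
      refine hηn _ fun w => ?_
      have := ha (w.1, w.2 • y)
      simpa [p, X', Z', hy] using this
    have h4 : a.1 = 0 := congrArg Prod.fst h3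
    have h5 : Y a.2 = 0 := congrArg Prod.snd h3
    exact Prod.ext h4 (hsep _ h1 h5 h2)

/-- Trivial extensions of the four-dimensional filiform algebra. -/
theorem isSymplectic_trivExt_of_filiform {X Y U V : Module.Dual ℝ L} {x y u v : L}
    (hX : ∀ a b : L, X ⁅a, b⁆ = 0) (hY : ∀ a b : L, Y ⁅a, b⁆ = 0)
    (hU : ∀ a b : L, U ⁅a, b⁆ = X a * Y b - X b * Y a)
    (hV : ∀ a b : L, V ⁅a, b⁆ = X a * U b - X b * U a)
    (hx : X x = 1 ∧ Y x = 0 ∧ U x = 0 ∧ V x = 0) (hy : X y = 0 ∧ Y y = 1 ∧ U y = 0 ∧ V y = 0)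
    (hu : X u = 0 ∧ Y u = 0 ∧ U u = 1 ∧ V u = 0) (hv : X v = 0 ∧ Y v = 0 ∧ U v = 0 ∧ V v = 1)
    (hsep : ∀ a, X a = 0 → Y a = 0 → U a = 0 → V a = 0 → a = 0) {s : ℕ} (hs : Even s) :
    IsSymplectic (TrivExt L s) := by
  obtain ⟨η, hη, hηn⟩ := exists_nondegenerate_alternating (AbelianLie s)
    (by rwa [finrank_abelianLie])
  let p : TrivExt L s →ₗ[ℝ] AbelianLie s := LinearMap.fst ℝ _ _
  have hp : ∀ a b : TrivExt L s, p ⁅a, b⁆ = 0 := fun a b => rfl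
  let q : TrivExt L s →ₗ[ℝ] L := LinearMap.snd ℝ _ _
  have hq : ∀ a b : TrivExt L s, q ⁅a, b⁆ = ⁅q a, q b⁆ := fun a b => rfl
  -- With dU = X ∧ Y and dV = X ∧ U, both X ∧ V and Y ∧ U are closed, each differential having a
  -- repeated factor.
  refine isSymplectic_of_bilin (η.compl₁₂ p p + (wedgeBilin X V + wedgeBilin Y U).compl₁₂ q q)
    (fun a => ?_) (fun a b c => ?_) (fun a ha => ?_)
  · simp only [LinearMap.add_apply, LinearMap.compl₁₂_apply, hη, wedgeBilin_apply]
    ring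
  · simp only [LinearMap.add_apply, LinearMap.compl₁₂_apply, hp, hq, map_zero, wedgeBilin_apply,
      LinearMap.zero_apply, hX, hY, hU, hV]
    ring
  · simp only [LinearMap.add_apply, LinearMap.compl₁₂_apply, wedgeBilin_apply] at ha
    have h1 : X a.2 = 0 := by simpa [p, q, hv] using ha (0, v)
    have h2 : V a.2 = 0 := by simpa [p, q, hx] using ha (0, x)
    have h3 : Y a.2 = 0 := by simpa [p, q, hu] using ha (0, u)
    have h4 : U a.2 = 0 := by simpa [p, q, hy] using ha (0, y)
    have h5 : a.1 = 0 := hηn _ fun w => by simpa [p, q] using ha (w, 0)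
    exact Prod.ext h5 (hsep _ h1 h3 h4 h2)

/-! ### Closed two-forms and Heisenberg subspaces -/

variable {ω : Cochain L 2} (hω : ceDiff L 2 ω = 0) {z e : L} (hz : ∀ x : L, ⁅z, x⁆ = 0)
  (hze : ω ![z, e] ≠ 0) {V : Submodule ℝ L} (hV : ∀ u ∈ V, ∀ v ∈ V, ∃ c : ℝ, ⁅u, v⁆ = c • z)
  (hn : ∀ u ∈ V, (∀ v ∈ V, ⁅u, v⁆ = 0) → u = 0)

-- The map u ↦ (ω(z, u), ω([u, e], e)) from V to ℝ² is injective. If both values vanish, then [u, e]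
-- = 0 because ω(z, e) ≠ 0. Closedness on (u, v, e) then gives ω([u, v], e) = 0, so [u, v] = 0 for
-- all v in V.
include hω hze hV hn in
theorem finrank_le_two_of_heisenberg (he : e ∈ V) : Module.finrank ℝ V ≤ 2 := by
  rw [ceDiff_two_eq_zero_iff] at hω
  rw [← toBilin_apply] at hze
  let f : V →ₗ[ℝ] ℝ × ℝ :=
    LinearMap.prod (toBilin ω z ∘ₗ V.subtype)
      ((toBilin ω).flip e ∘ₗ (-(LieAlgebra.ad ℝ L e : L →ₗ[ℝ] L)) ∘ₗ V.subtype)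
  have hf : Function.Injective f := by
    rw [← LinearMap.ker_eq_bot, LinearMap.ker_eq_bot']
    rintro ⟨u, hu⟩ h
    have h1 : toBilin ω z u = 0 := congrArg Prod.fst h
    have h2 : toBilin ω ⁅u, e⁆ e = 0 := by
      rw [← lie_skew]
      exact congrArg Prod.snd h
    have h3 : ⁅e, u⁆ = 0 := by
      obtain ⟨c, hc⟩ := hV u hu e he
      rw [hc, map_smul, LinearMap.smul_apply, smul_eq_mul] at h2
      rw [← lie_skew, hc, (mul_eq_zero.mp h2).resolve_right hze, zero_smul, neg_zero]
    ext1
    refine hn u hu fun v hv => ?_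
    obtain ⟨c, hc⟩ := hV u hu v hv
    obtain ⟨c', hc'⟩ := hV v hv e he
    have := hω u v e
    rw [h3, hc, hc', map_smul, map_smul, LinearMap.smul_apply, LinearMap.smul_apply, h1] at this
    simp only [smul_eq_mul, mul_zero, add_zero, map_zero, LinearMap.zero_apply] at this
    rw [hc, (mul_eq_zero.mp this).resolve_right hze, zero_smul]
  have := LinearMap.finrank_le_finrank_of_injective hf
  simpa using this

-- On V the form σ(u, v) = ω([u, v], e) is non-degenerate, so ω(u, v) = σ(Tu, v) for some
-- endomorphism T. With A = ad e, closedness on (u, v, e) reads AT - TA = 1, and a commutator has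
-- trace zero.
include hω hz hze hV hn in
theorem eq_bot_of_heisenberg [FiniteDimensional ℝ L] (he : ∀ v ∈ V, ⁅e, v⁆ ∈ V) : V = ⊥ := by
  rw [ceDiff_two_eq_zero_iff] at hω
  rw [← toBilin_apply] at hze
  set c := toBilin ω z e with hc
  let A : V →ₗ[ℝ] V := (LieAlgebra.ad ℝ L e : L →ₗ[ℝ] L).restrict he
  let τ : V →ₗ[ℝ] Module.Dual ℝ V := (toBilin ω).compl₁₂ V.subtype V.subtype
  let σ : V →ₗ[ℝ] Module.Dual ℝ V :=
    LinearMap.mk₂ ℝ (fun u v => toBilin ω ⁅(u : L), (v : L)⁆ e)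
      (fun u u' v => by simp) (fun a u v => by simp)
      (fun u v v' => by simp) (fun a u v => by simp)
  have hσ' : ∀ u v, σ u v = toBilin ω ⁅(u : L), (v : L)⁆ e := fun _ _ => rfl
  have hσ : Function.Injective σ := by
    rw [← LinearMap.ker_eq_bot, LinearMap.ker_eq_bot']
    rintro ⟨u, hu⟩ h
    ext1
    refine hn u hu fun v hv => ?_
    have := LinearMap.congr_fun h ⟨v, hv⟩
    obtain ⟨r, hr⟩ := hV u hu v hv
    rw [hσ', hr, map_smul, LinearMap.smul_apply, smul_eq_mul] at this
    rw [hr, (mul_eq_zero.mp this).resolve_right hze, zero_smul]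
  let S : V ≃ₗ[ℝ] Module.Dual ℝ V :=
    LinearEquiv.ofInjectiveOfFinrankEq σ hσ (Subspace.dual_finrank_eq).symm
  have hS : ∀ u, S u = σ u := fun _ => rfl
  obtain ⟨T, hT⟩ : ∃ T : V →ₗ[ℝ] V, ∀ u v, σ (T u) v = toBilin ω u v :=
    ⟨S.symm.toLinearMap ∘ₗ τ, fun u v => by rw [← hS]; simp [τ]⟩
  -- The derivation ad e kills [u, v], which is a multiple of the central z, so A is skew for σ.
  have hA : ∀ u v, σ (A u) v = - σ u (A v) := fun u v => by
    obtain ⟨r, hr⟩ := hV u u.2 v v.2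
    have h1 : ⁅e, ⁅(u : L), (v : L)⁆⁆ = 0 := by
      rw [hr, lie_smul, ← lie_skew, hz, neg_zero, smul_zero]
    rw [leibniz_lie] at h1
    rw [hσ', hσ', eq_neg_iff_add_eq_zero, ← LinearMap.add_apply, ← map_add]
    change toBilin ω (⁅⁅e, (u : L)⁆, (v : L)⁆ + ⁅(u : L), ⁅e, (v : L)⁆⁆) e = 0
    rw [h1, map_zero, LinearMap.zero_apply]
  have key : A ∘ₗ T - T ∘ₗ A = LinearMap.id := by
    refine LinearMap.ext fun u => hσ (LinearMap.ext fun v => ?_)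
    rw [LinearMap.sub_apply, map_sub, LinearMap.sub_apply, LinearMap.comp_apply,
      LinearMap.comp_apply, hA, hT, hT, LinearMap.id_apply, hσ']
    have := hω u v e
    have e1 : ((A v : V) : L) = ⁅e, (v : L)⁆ := rfl
    have e2 : ((A u : V) : L) = ⁅e, (u : L)⁆ := rfl
    rw [e1, e2, toBilin_swap ω (u : L), ← lie_skew e (v : L), map_neg, LinearMap.neg_apply]
    linarith
  have htr := congrArg (LinearMap.trace ℝ V) key
  rw [map_sub, LinearMap.trace_comp_comm', sub_self, LinearMap.trace_id] at htr
  have : Module.finrank ℝ V = 0 := by exact_mod_cast htr.symm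
  exact Submodule.finrank_eq_zero.mp this

end Symplectic

/-! ### Roots around a top root θ -/

section RootPairing

open Set Submodule

variable {ι R M N : Type*} [Finite ι] [Field R] [CharZero R] [AddCommGroup M] [Module R M]
  [AddCommGroup N] [Module R N] {P : RootPairing ι R M N} [P.IsCrystallographic]

omit [Finite ι] in
theorem pairingIn_add {i j k : ι} (h : P.root k = P.root i + P.root j) (l : ι) :
    P.pairingIn ℤ k l = P.pairingIn ℤ i l + P.pairingIn ℤ j l := by
  apply (algebraMap ℤ R).injective_int
  simp only [map_add, P.algebraMap_pairingIn, ← P.root_coroot'_eq_pairing, h]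

omit [Finite ι] in
theorem pairingIn_sub {i j k : ι} (h : P.root k = P.root i - P.root j) (l : ι) :
    P.pairingIn ℤ k l = P.pairingIn ℤ i l - P.pairingIn ℤ j l := by
  have := pairingIn_add (P := P) (i := k) (j := j) (k := i) (by rw [h, sub_add_cancel]) l
  omega

omit [Finite ι] in
theorem pairingIn_neg {i k : ι} (h : P.root k = - P.root i) (l : ι) :
    P.pairingIn ℤ k l = - P.pairingIn ℤ i l := by
  apply (algebraMap ℤ R).injective_int
  simp only [map_neg, P.algebraMap_pairingIn, ← P.root_coroot'_eq_pairing, h]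

variable (b : P.Base)

omit [Finite ι] [P.IsCrystallographic] in
theorem exists_root_eq_neg (i : ι) : ∃ j, P.root j = - P.root i ∧ (b.IsPos j ↔ ¬ b.IsPos i) := by
  let _ := P.indexNeg
  exact ⟨-i, by simp, RootPairing.Base.IsPos.neg_iff_not b i⟩

/-- A positive root `θ` such that no `θ + β` with `β > 0` is a root. -/
def IsTopRoot (θ : ι) : Prop :=
  b.IsPos θ ∧ ∀ β, b.IsPos β → P.root θ + P.root β ∉ range P.root

-- A root of maximal height works, since heights add.
omit [P.IsCrystallographic] in
theorem exists_isTopRoot [Nonempty ι] : ∃ θ, IsTopRoot b θ := by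
  obtain ⟨θ, hθ⟩ := Finite.exists_max b.height
  have hpos : b.IsPos θ := by
    obtain ⟨j, -, hj⟩ := exists_root_eq_neg b θ
    by_contra h
    have h1 := hj.mpr h
    have h2 := hθ j
    rw [RootPairing.Base.isPos_iff] at h h1
    omega
  refine ⟨θ, hpos, ?_⟩
  rintro β hβ ⟨k, hk⟩
  have h1 := b.height_add hk
  have h2 := hθ k
  rw [RootPairing.Base.isPos_iff] at hβ
  omega

variable {b} {θ : ι} (hθ : IsTopRoot b θ)

-- A positive pairing makes γ - θ a root. Both γ and γ' = θ - γ must be positive, since otherwise θ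
-- plus a positive root would be a root. The pairings of γ and γ' with θ^∨ sum to 2, so it remains
-- to exclude values of at least 2.
include hθ in
theorem IsTopRoot.of_pairingIn_pos {γ : ι} (hne : γ ≠ θ) (h : 0 < P.pairingIn ℤ γ θ) :
    P.pairingIn ℤ γ θ = 1 ∧ b.IsPos γ ∧ ∃ γ', b.IsPos γ' ∧ P.root γ' = P.root θ - P.root γ ∧
      P.pairingIn ℤ γ' θ = 1 := by
  obtain ⟨hp, hθ⟩ := hθ
  obtain ⟨k, hk⟩ := P.root_sub_root_mem_of_pairingIn_pos h hne
  obtain ⟨γ', hγ', hpos'⟩ := exists_root_eq_neg b k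
  have hγ'r : P.root γ' = P.root θ - P.root γ := by rw [hγ', hk, neg_sub]
  have hγ'pos : b.IsPos γ' := hpos'.mpr fun hkp => hθ k hkp ⟨γ, by rw [hk]; abel⟩
  have hγpos : b.IsPos γ := by
    by_contra hn
    obtain ⟨j, hj, hjpos⟩ := exists_root_eq_neg b γ
    exact hθ j (hjpos.mpr hn) ⟨γ', by rw [hj, hγ'r]; abel⟩
  have h2 : P.pairingIn ℤ γ' θ = 2 - P.pairingIn ℤ γ θ := by
    rw [pairingIn_sub hγ'r, P.pairingIn_same]
  -- Here γ' would pair negatively with θ^∨, making γ' + θ a root.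
  have h3 : ¬ 2 < P.pairingIn ℤ γ θ := fun h3 => by
    have hne' : P.root γ' ≠ - P.root θ := fun he => by
      obtain ⟨j, hj, hjpos⟩ := exists_root_eq_neg b θ
      have : γ' = j := P.root.injective (by rw [he, hj])
      exact hjpos.mp (this ▸ hγ'pos) hp
    have := P.root_add_root_mem_of_pairingIn_neg (by omega) hne'
    exact hθ γ' hγ'pos (by rwa [add_comm])
  -- The reflection of γ in θ would be γ - 2θ, whose negative is θ + γ'.
  have h4 : P.pairingIn ℤ γ θ ≠ 2 := fun h4 => by
    obtain ⟨j, hj, -⟩ := exists_root_eq_neg b (P.reflectionPerm θ γ)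
    refine hθ γ' hγ'pos ⟨j, ?_⟩
    rw [hj, P.root_reflectionPerm, P.reflection_apply_root' ℤ, h4, hγ'r, two_smul]
    abel
  have h5 : P.pairingIn ℤ γ θ = 1 := by omega
  exact ⟨h5, hγpos, γ', hγ'pos, hγ'r, by omega⟩

omit [Finite ι] in
theorem IsTopRoot.ne_of_pairingIn_eq_one {γ : ι} (h : P.pairingIn ℤ γ θ = 1) : γ ≠ θ := by
  rintro rfl
  rw [P.pairingIn_same] at h
  omega

include hθ in
theorem IsTopRoot.isPos_of_pairingIn_eq_one {γ : ι} (h : P.pairingIn ℤ γ θ = 1) : b.IsPos γ :=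
  (hθ.of_pairingIn_pos (ne_of_pairingIn_eq_one h) (by omega)).2.1

include hθ in
theorem IsTopRoot.exists_complement {γ : ι} (h : P.pairingIn ℤ γ θ = 1) :
    ∃ γ', P.root γ' = P.root θ - P.root γ ∧ P.pairingIn ℤ γ' θ = 1 := by
  obtain ⟨-, -, γ', -, h1, h2⟩ := hθ.of_pairingIn_pos (ne_of_pairingIn_eq_one h) (by omega)
  exact ⟨γ', h1, h2⟩

-- A negative pairing is impossible: -γ would pair positively with θ^∨ and hence be positive.
include hθ in
theorem IsTopRoot.pairingIn_of_isPos {γ : ι} (h : b.IsPos γ) :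
    γ = θ ∨ P.pairingIn ℤ γ θ = 1 ∨ P.pairingIn ℤ γ θ = 0 := by
  by_cases hne : γ = θ
  · exact Or.inl hne
  rcases lt_trichotomy (P.pairingIn ℤ γ θ) 0 with h1 | h1 | h1
  · exfalso
    obtain ⟨j, hj, hjpos⟩ := exists_root_eq_neg b γ
    have hjθ : j ≠ θ := by
      rintro rfl
      exact hjpos.mp hθ.1 h
    have := (hθ.of_pairingIn_pos hjθ (by rw [pairingIn_neg hj]; omega)).2.1
    exact hjpos.mp this h
  · exact Or.inr (Or.inr h1)
  · exact Or.inr (Or.inl (hθ.of_pairingIn_pos hne h1).1)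

-- The sum pairs to 2 with θ^∨, and θ is the only positive root doing so.
include hθ in
theorem IsTopRoot.eq_of_add_eq {γ δ k : ι} (h1 : P.pairingIn ℤ γ θ = 1)
    (h2 : P.pairingIn ℤ δ θ = 1) (hk : P.root k = P.root γ + P.root δ) : k = θ := by
  have h := pairingIn_add hk θ
  rcases hθ.pairingIn_of_isPos ((hθ.isPos_of_pairingIn_eq_one h1).add
    (hθ.isPos_of_pairingIn_eq_one h2) hk) with h3 | h3 | h3
  · exact h3
  · omega
  · omega

variable [P.IsReduced]

omit [Finite ι] in
theorem linearIndependent_of_pairingIn_eq_one {γ : ι} (h : P.pairingIn ℤ γ θ = 1) :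
    LinearIndependent R ![P.root θ, P.root γ] := by
  refine RootPairing.IsReduced.linearIndependent P
    (IsTopRoot.ne_of_pairingIn_eq_one h).symm fun h' => ?_
  have := pairingIn_neg h' θ
  rw [P.pairingIn_same] at this
  omega

-- The involution γ ↦ θ - γ has no fixed point, as θ = 2γ contradicts the independence of θ and γ.
-- The count is done modulo 2.
include hθ in
open Classical in
theorem IsTopRoot.even_card [Fintype ι] :
    Even (Finset.univ.filter fun γ => P.pairingIn ℤ γ θ = 1).card := by
  choose f hf1 hf2 using fun (γ : ι) (h : P.pairingIn ℤ γ θ = 1) => hθ.exists_complement h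
  have hff : ∀ γ h, f (f γ h) (hf2 γ h) = γ := fun γ h =>
    P.root.injective (by rw [hf1, hf1, sub_sub_cancel])
  have := Finset.sum_involution (s := Finset.univ.filter fun γ => P.pairingIn ℤ γ θ = 1)
    (f := fun _ => (1 : ZMod 2)) (fun γ hγ => f γ (Finset.mem_filter.mp hγ).2)
    (fun γ hγ => by decide)
    (fun γ hγ _ he => by
      have h := (Finset.mem_filter.mp hγ).2
      have h1 := hf1 γ h
      rw [he] at h1
      have h2 := LinearIndependent.pair_iff.mp (linearIndependent_of_pairingIn_eq_one h) (-1) 2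
        (by rw [neg_smul, one_smul, two_smul]; nth_rewrite 1 [h1]; abel)
      exact two_ne_zero h2.2)
    (fun γ hγ => Finset.mem_filter.mpr ⟨Finset.mem_univ _, hf2 γ _⟩)
    (fun γ hγ => hff γ _)
  rw [Finset.sum_const, nsmul_one, ZMod.natCast_eq_zero_iff_even] at this
  exact this

omit [Finite ι] [P.IsReduced] in
theorem pairingIn_eq_zero_iff_coroot' {i j : ι} :
    P.pairingIn ℤ i j = 0 ↔ P.coroot' j (P.root i) = 0 := by
  rw [P.root_coroot'_eq_pairing, ← P.algebraMap_pairingIn ℤ]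
  simp

/-! ### Consequences of irreducibility -/

section Irreducible

variable [P.IsIrreducible]

omit [P.IsReduced] [P.IsIrreducible] in
include hθ in
/-- Every root is `± θ`, or one of `± γ` with `γ` pairing to `1` with the coroot of `θ`, or is
orthogonal to `θ`. -/
theorem IsTopRoot.trichotomy (i : ι) :
    P.pairingIn ℤ i θ = 0 ∨ (P.root i = P.root θ ∨ P.root i = - P.root θ) ∨
      ∃ γ, P.pairingIn ℤ γ θ = 1 ∧ (P.root i = P.root γ ∨ P.root i = - P.root γ) := by
  by_cases hi : b.IsPos i
  · rcases hθ.pairingIn_of_isPos hi with rfl | h | h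
    · exact Or.inr (Or.inl (Or.inl rfl))
    · exact Or.inr (Or.inr ⟨i, h, Or.inl rfl⟩)
    · exact Or.inl h
  · obtain ⟨j, hj, hjpos⟩ := exists_root_eq_neg b i
    have hji : P.root i = - P.root j := by rw [hj, neg_neg]
    rcases hθ.pairingIn_of_isPos (hjpos.mpr hi) with rfl | h | h
    · exact Or.inr (Or.inl (Or.inr hji))
    · exact Or.inr (Or.inr ⟨j, h, Or.inr hji⟩)
    · exact Or.inl (by rw [pairingIn_neg hji, h, neg_zero])

-- Such a q is stable under every reflection: subtracting a multiple of a root in q stays in q, and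
-- the other reflections fix q pointwise.
omit [CharZero R] [Finite ι] [P.IsCrystallographic] [P.IsReduced] in
theorem eq_top_of_forall_mem_or_le_ker {q : Submodule R M} (hq : q ≠ ⊥)
    (h : ∀ i, P.root i ∈ q ∨ q ≤ LinearMap.ker (P.coroot' i)) : q = ⊤ := by
  refine RootPairing.IsIrreducible.eq_top_of_invtSubmodule_reflection (P := P) q (fun i x hx => ?_) hq
  change P.reflection i x ∈ q
  rw [P.reflection_apply]
  rcases h i with h | h
  · exact q.sub_mem hx (q.smul_mem _ h)
  · rw [LinearMap.mem_ker.mp (h hx), zero_smul, sub_zero]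
    exact hx

-- Without roots pairing to 1, each root is ± θ or orthogonal to θ, so the line of θ is stable under
-- all reflections.
omit [P.IsReduced] in
include hθ in
theorem IsTopRoot.finrank_eq_one (h : ∀ γ, P.pairingIn ℤ γ θ ≠ 1) : Module.finrank R M = 1 := by
  have : R ∙ P.root θ = ⊤ := by
    refine eq_top_of_forall_mem_or_le_ker (P := P)
      (by simpa using P.ne_zero θ) fun i => ?_
    rcases hθ.trichotomy i with h1 | (h1 | h1) | ⟨γ, h1, -⟩
    · right
      rw [Submodule.span_singleton_le_iff_mem, LinearMap.mem_ker, ← pairingIn_eq_zero_iff_coroot']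
      exact P.pairingIn_eq_zero_iff.mp h1
    · left
      rw [h1]
      exact Submodule.mem_span_singleton_self _
    · left
      rw [h1]
      exact neg_mem (Submodule.mem_span_singleton_self _)
    · exact absurd h1 (h γ)
  rw [← finrank_top, ← this, finrank_span_singleton (P.ne_zero θ)]

-- The plane of θ and β contains ± θ and every ± γ with γ pairing to 1. A root i outside it is
-- orthogonal to θ. It is also orthogonal to β, because a root β ± i would pair to 1 with θ^∨, hence
-- lie in the plane and bring i with it. So the plane is stable under all reflections.
omit [P.IsReduced] in
include hθ in
theorem IsTopRoot.span_eq_top {β β' : ι} (hβ : P.pairingIn ℤ β θ = 1)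
    (hβ' : P.root β' = P.root θ - P.root β)
    (h : ∀ γ, P.pairingIn ℤ γ θ = 1 → γ = β ∨ γ = β') :
    span R (range ![P.root θ, P.root β]) = ⊤ := by
  set q := span R (range ![P.root θ, P.root β]) with hq
  have hθq : P.root θ ∈ q := subset_span ⟨0, rfl⟩
  have hβq : P.root β ∈ q := subset_span ⟨1, rfl⟩
  have hγq : ∀ γ, P.pairingIn ℤ γ θ = 1 → P.root γ ∈ q := fun γ hγ => by
    rcases h γ hγ with rfl | rfl
    · exact hβq
    · rw [hβ']; exact sub_mem hθq hβq
  refine eq_top_of_forall_mem_or_le_ker (P := P) ?_ fun i => ?_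
  · intro hb
    rw [hb] at hθq
    exact P.ne_zero θ (by simpa using hθq)
  by_cases hi : P.root i ∈ q
  · exact Or.inl hi
  right
  have h0 : P.pairingIn ℤ i θ = 0 := by
    rcases hθ.trichotomy i with h1 | (h1 | h1) | ⟨γ, hγ, h1 | h1⟩
    · exact h1
    · exact absurd (h1 ▸ hθq) hi
    · exact absurd (h1 ▸ neg_mem hθq) hi
    · exact absurd (h1 ▸ hγq γ hγ) hi
    · exact absurd (h1 ▸ neg_mem (hγq γ hγ)) hi
  have hβi : P.pairingIn ℤ β i = 0 := by
    apply P.pairingIn_eq_zero_of_add_notMem_of_sub_notMem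
    · rintro rfl; exact hi hβq
    · intro h'; exact hi (by rw [← neg_neg (P.root i), ← h']; exact neg_mem hβq)
    · rintro ⟨k, hk⟩
      have := hγq k (by rw [pairingIn_add hk]; omega)
      exact hi (by rw [show P.root i = P.root k - P.root β by rw [hk]; abel]; exact sub_mem this hβq)
    · rintro ⟨k, hk⟩
      have := hγq k (by rw [pairingIn_sub hk]; omega)
      exact hi (by rw [show P.root i = P.root β - P.root k by rw [hk]; abel]; exact sub_mem hβq this)
  rw [hq, span_le]
  rintro _ ⟨j, rfl⟩
  fin_cases j
  · exact pairingIn_eq_zero_iff_coroot'.mp (P.pairingIn_eq_zero_iff.mp h0)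
  · exact pairingIn_eq_zero_iff_coroot'.mp hβi

include hθ in
theorem IsTopRoot.finrank_eq_two {β β' : ι} (hβ : P.pairingIn ℤ β θ = 1)
    (hβ' : P.root β' = P.root θ - P.root β)
    (h : ∀ γ, P.pairingIn ℤ γ θ = 1 → γ = β ∨ γ = β') : Module.finrank R M = 2 := by
  rw [← finrank_top, ← hθ.span_eq_top hβ hβ' h,
    finrank_span_eq_card (linearIndependent_of_pairingIn_eq_one hβ), Fintype.card_fin]

-- In rank two, two distinct positive roots span the space, so they cannot both lie in the kernel of
-- θ^∨.
include hθ in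
theorem IsTopRoot.orthogonal_unique {β β' : ι} (hβ : P.pairingIn ℤ β θ = 1)
    (hβ' : P.root β' = P.root θ - P.root β)
    (h : ∀ γ, P.pairingIn ℤ γ θ = 1 → γ = β ∨ γ = β') {δ δ' : ι} (hδ : b.IsPos δ)
    (hδ' : b.IsPos δ') (h0 : P.pairingIn ℤ δ θ = 0) (h0' : P.pairingIn ℤ δ' θ = 0) : δ = δ' := by
  by_contra hne
  have hli : LinearIndependent R ![P.root δ, P.root δ'] := by
    refine RootPairing.IsReduced.linearIndependent P hne fun h' => ?_
    obtain ⟨j, hj, hjpos⟩ := exists_root_eq_neg b δ'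
    have : δ = j := P.root.injective (by rw [h', hj])
    exact hjpos.mp (this ▸ hδ) hδ'
  have hfr := hθ.finrank_eq_two hβ hβ' h
  have : Nontrivial M := RootPairing.IsIrreducible.nontrivial P
  have hsp := hli.span_eq_top_of_card_eq_finrank (by rw [hfr, Fintype.card_fin])
  have hle : span R (range ![P.root δ, P.root δ']) ≤ LinearMap.ker (P.coroot' θ) := by
    rw [span_le]
    rintro _ ⟨j, rfl⟩
    fin_cases j
    · exact pairingIn_eq_zero_iff_coroot'.mp h0
    · exact pairingIn_eq_zero_iff_coroot'.mp h0'
  rw [hsp] at hle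
  have h1 : P.coroot' θ (P.root θ) = 0 := hle trivial
  rw [P.root_coroot'_eq_pairing, P.pairing_same] at h1
  exact two_ne_zero h1

-- If β were orthogonal to δ, the coroot of δ would vanish on the span of θ and β, which is
-- everything. So β + δ or β - δ is a root; it pairs to 1 with θ^∨ and differs from β, hence is β'.
omit [P.IsReduced] in
include hθ in
theorem IsTopRoot.eq_add_or_eq_sub {β β' : ι} (hβ : P.pairingIn ℤ β θ = 1)
    (hβ' : P.root β' = P.root θ - P.root β)
    (h : ∀ γ, P.pairingIn ℤ γ θ = 1 → γ = β ∨ γ = β') {δ : ι} (h0 : P.pairingIn ℤ δ θ = 0) :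
    P.pairingIn ℤ β δ ≠ 0 ∧
    (P.root β' = P.root β + P.root δ ∨ P.root β' = P.root β - P.root δ) := by
  have hne : P.pairingIn ℤ β δ ≠ 0 := by
    intro h1
    have hle : span R (range ![P.root θ, P.root β]) ≤ LinearMap.ker (P.coroot' δ) := by
      rw [span_le]
      rintro _ ⟨j, rfl⟩
      fin_cases j
      · exact pairingIn_eq_zero_iff_coroot'.mp (P.pairingIn_eq_zero_iff.mp h0)
      · exact pairingIn_eq_zero_iff_coroot'.mp h1
    rw [hθ.span_eq_top hβ hβ' h] at hle
    have h1 : P.coroot' δ (P.root δ) = 0 := hle trivial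
    rw [P.root_coroot'_eq_pairing, P.pairing_same] at h1
    exact two_ne_zero h1
  refine ⟨hne, ?_⟩
  by_contra! hcon
  refine hne (P.pairingIn_eq_zero_of_add_notMem_of_sub_notMem ?_ ?_ ?_ ?_)
  · rintro rfl; omega
  · intro h'
    have := pairingIn_neg h' θ
    omega
  · rintro ⟨k, hk⟩
    rcases h k (by rw [pairingIn_add hk]; omega) with rfl | rfl
    · exact P.ne_zero δ (by simpa using hk)
    · exact hcon.1 hk
  · rintro ⟨k, hk⟩
    rcases h k (by rw [pairingIn_sub hk]; omega) with rfl | rfl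
    · exact P.ne_zero δ (sub_eq_self.mp hk.symm)
    · exact hcon.2 hk

/-! ### Counting positive roots -/

section Counting

variable [Fintype ι]

open Classical in
variable (b) in
omit [Finite ι] [P.IsCrystallographic] [P.IsReduced] [P.IsIrreducible] in
theorem card_eq_two_mul_card_isPos :
    Fintype.card ι = 2 * (Finset.univ.filter fun γ => b.IsPos γ).card := by
  choose f hf1 hf2 using exists_root_eq_neg b
  have hff : ∀ i, f (f i) = i := fun i => P.root.injective (by rw [hf1, hf1, neg_neg])
  have : (Finset.univ.filter fun γ => b.IsPos γ).card =
      (Finset.univ.filter fun γ => ¬ b.IsPos γ).card := by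
    refine Finset.card_bij' (fun i _ => f i) (fun i _ => f i) (fun i hi => ?_) (fun i hi => ?_)
      (fun i _ => hff i) (fun i _ => hff i)
    · simpa [hf2] using hi
    · simpa [hf2] using hi
  rw [← Finset.card_univ, ← Finset.card_filter_add_card_filter_not (fun γ => b.IsPos γ)]
  omega

open Classical in
include hθ in
omit [P.IsReduced] [P.IsIrreducible] in
theorem IsTopRoot.card_isPos : (Finset.univ.filter fun γ => b.IsPos γ).card =
    1 + (Finset.univ.filter fun γ => P.pairingIn ℤ γ θ = 1).card +
      (Finset.univ.filter fun γ => b.IsPos γ ∧ P.pairingIn ℤ γ θ = 0).card := by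
  have h1 : (Finset.univ.filter fun γ => b.IsPos γ) =
      ({θ} ∪ Finset.univ.filter fun γ => P.pairingIn ℤ γ θ = 1) ∪
        Finset.univ.filter fun γ => b.IsPos γ ∧ P.pairingIn ℤ γ θ = 0 := by
    ext γ
    simp only [Finset.mem_filter, Finset.mem_univ, true_and, Finset.mem_union,
      Finset.mem_singleton]
    constructor
    · intro h
      rcases hθ.pairingIn_of_isPos h with h' | h' | h'
      · exact Or.inl (Or.inl h')
      · exact Or.inl (Or.inr h')
      · exact Or.inr ⟨h, h'⟩
    · rintro ((rfl | h) | h)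
      · exact hθ.1
      · exact hθ.isPos_of_pairingIn_eq_one h
      · exact h.1
  rw [h1, Finset.card_union_of_disjoint, Finset.card_union_of_disjoint, Finset.card_singleton]
  · rw [Finset.disjoint_left]
    intro γ h
    rw [Finset.mem_singleton.mp h, Finset.mem_filter, P.pairingIn_same]
    omega
  · rw [Finset.disjoint_left]
    intro γ h
    simp only [Finset.mem_filter, Finset.mem_univ, true_and, Finset.mem_union,
      Finset.mem_singleton] at h ⊢
    rintro ⟨-, h'⟩
    rcases h with rfl | h
    · rw [P.pairingIn_same] at h'; omega
    · omega

variable (b θ) in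
/-- The root `θ` is a sum of two roots in exactly one way. -/
def HasUniqueSplitting (β β' : ι) : Prop :=
  P.pairingIn ℤ β θ = 1 ∧ P.root β' = P.root θ - P.root β ∧
    ∀ γ, P.pairingIn ℤ γ θ = 1 → γ = β ∨ γ = β'

-- Otherwise the rank would be one, but two distinct positive roots are independent.
open Classical in
include hθ in
theorem IsTopRoot.exists_pairingIn_eq_one
    (h2 : 2 ≤ (Finset.univ.filter fun γ => b.IsPos γ).card) : ∃ β, P.pairingIn ℤ β θ = 1 := by
  by_contra! hex
  have hfr := hθ.finrank_eq_one hex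
  obtain ⟨γ, hγ, hne⟩ := Finset.exists_mem_ne (Nat.lt_of_succ_le h2) θ
  have hγ := (Finset.mem_filter.mp hγ).2
  have hli : LinearIndependent R ![P.root γ, P.root θ] := by
    refine RootPairing.IsReduced.linearIndependent P hne fun h' => ?_
    obtain ⟨j, hj, hjpos⟩ := exists_root_eq_neg b θ
    have : γ = j := P.root.injective (by rw [h', hj])
    exact hjpos.mp (this ▸ hγ) hθ.1
  have : Module.Finite R M := Module.finite_of_finrank_pos (by omega)
  have := hli.fintype_card_le_finrank
  rw [hfr, Fintype.card_fin] at this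
  omega

open Classical in
include hθ in
theorem IsTopRoot.exists_hasUniqueSplitting
    (h2 : 2 ≤ (Finset.univ.filter fun γ => b.IsPos γ).card)
    (hS : (Finset.univ.filter fun γ => P.pairingIn ℤ γ θ = 1).card ≤ 2) :
    ∃ β β', HasUniqueSplitting (P := P) θ β β' := by
  obtain ⟨β, hβ⟩ := hθ.exists_pairingIn_eq_one h2
  obtain ⟨β', h1, h2⟩ := hθ.exists_complement hβ
  refine ⟨β, β', hβ, h1, fun γ hγ => ?_⟩
  by_contra! hcon
  have hne : β ≠ β' := by
    rintro rfl
    have h3 := LinearIndependent.pair_iff.mp (linearIndependent_of_pairingIn_eq_one hβ) (-1) 2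
      (by rw [neg_smul, one_smul, two_smul]; nth_rewrite 1 [h1]; abel)
    exact two_ne_zero h3.2
  have : ({γ, β, β'} : Finset ι).card = 3 := by
    rw [Finset.card_eq_three]
    exact ⟨γ, β, β', hcon.1, hcon.2, hne, rfl⟩
  have h3 : ({γ, β, β'} : Finset ι) ⊆ Finset.univ.filter fun γ => P.pairingIn ℤ γ θ = 1 := by
    intro x hx
    simp only [Finset.mem_insert, Finset.mem_singleton] at hx
    rw [Finset.mem_filter]
    refine ⟨Finset.mem_univ _, ?_⟩
    rcases hx with rfl | rfl | rfl <;> assumption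
  have := Finset.card_le_card h3
  omega

-- The positive roots are θ, the two roots β and β', and at most one root orthogonal to θ.
open Classical in
include hθ in
theorem IsTopRoot.card_of_hasUniqueSplitting {β β' : ι}
    (h : HasUniqueSplitting (P := P) θ β β') :
    Module.finrank R M = 2 ∧ ((Finset.univ.filter fun γ => b.IsPos γ).card = 3 ∨
      (Finset.univ.filter fun γ => b.IsPos γ).card = 4) := by
  obtain ⟨h1, h2, h3⟩ := h
  have h4 : P.pairingIn ℤ β' θ = 1 := by rw [pairingIn_sub h2, P.pairingIn_same]; omega
  refine ⟨hθ.finrank_eq_two h1 h2 h3, ?_⟩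
  have hO : (Finset.univ.filter fun γ => b.IsPos γ ∧ P.pairingIn ℤ γ θ = 0).card ≤ 1 := by
    rw [Finset.card_le_one]
    intro δ hδ δ' hδ'
    rw [Finset.mem_filter] at hδ hδ'
    exact hθ.orthogonal_unique h1 h2 h3 hδ.2.1 hδ'.2.1 hδ.2.2 hδ'.2.2
  have hS : (Finset.univ.filter fun γ => P.pairingIn ℤ γ θ = 1).card ≤ 2 := by
    refine (Finset.card_le_card (t := {β, β'}) fun γ hγ => ?_).trans Finset.card_le_two
    simpa using h3 γ (Finset.mem_filter.mp hγ).2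
  have hS0 : 0 < (Finset.univ.filter fun γ => P.pairingIn ℤ γ θ = 1).card :=
    Finset.card_pos.mpr ⟨β, by simpa using h1⟩
  have hev := hθ.even_card
  obtain ⟨m, hm⟩ := hev
  rw [hθ.card_isPos]
  omega

-- The sum is the dimension of the Lie algebra. Its parity makes the rank even, hence at least 2, so
-- there are at most four positive roots and the even number of roots pairing to 1 is at most 2. A
-- single positive root would give rank one, of the wrong parity.
open Classical in
include hθ in
theorem IsTopRoot.exists_hasUniqueSplitting_of_dim [FiniteDimensional R M]
    (h : Module.finrank R M + Fintype.card ι = 8 ∨ Module.finrank R M + Fintype.card ι = 10) :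
    ∃ β β', HasUniqueSplitting (P := P) θ β β' := by
  have : Nontrivial M := RootPairing.IsIrreducible.nontrivial P
  have hr : 0 < Module.finrank R M := Module.finrank_pos
  rw [card_eq_two_mul_card_isPos b] at h
  have hp := hθ.card_isPos
  obtain ⟨m, hm⟩ := hθ.even_card
  refine hθ.exists_hasUniqueSplitting ?_ (by omega)
  by_contra! hlt
  have h0 : (Finset.univ.filter fun γ => P.pairingIn ℤ γ θ = 1).card = 0 := by omega
  have := hθ.finrank_eq_one fun γ hγ => by
    rw [Finset.card_eq_zero] at h0
    have : γ ∈ (∅ : Finset ι) := h0 ▸ Finset.mem_filter.mpr ⟨Finset.mem_univ _, hγ⟩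
    simp at this
  omega

end Counting

end Irreducible

end RootPairing

/-! ### Root vectors and their brackets -/

section RootVectors

open LieAlgebra LieAlgebra.IsKilling LieModule

variable {g₀ : Type*} [LieRing g₀] [LieAlgebra ℝ g₀] [FiniteDimensional ℝ g₀]
  [IsSemisimple ℝ g₀] {H : LieSubalgebra ℝ g₀} [H.IsCartanSubalgebra]
  [LieModule.IsTriangularizable ℝ H g₀]

theorem root_add_iff {α β γ : H.root} :
    (rootSystem H).root γ = (rootSystem H).root α + (rootSystem H).root β ↔
      (γ.1 : H → ℝ) = (α.1 : H → ℝ) + β.1 := by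
  constructor
  · intro h
    ext x
    exact LinearMap.congr_fun h x
  · intro h
    ext x
    exact congrFun h x

theorem lie_mem_rootSpace_of_root_eq_add {α β γ : H.root}
    (h : (rootSystem H).root γ = (rootSystem H).root α + (rootSystem H).root β) {x y : g₀}
    (hx : x ∈ rootSpace H α.1) (hy : y ∈ rootSpace H β.1) : ⁅x, y⁆ ∈ rootSpace H γ.1 := by
  rw [root_add_iff.mp h]
  exact lie_mem_genWeightSpace_of_mem_genWeightSpace hx hy

theorem lie_eq_zero_of_add_notMem {α β : H.root}
    (h0 : (rootSystem H).root α ≠ - (rootSystem H).root β)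
    (h : (rootSystem H).root α + (rootSystem H).root β ∉ Set.range (rootSystem H).root) {x y : g₀}
    (hx : x ∈ rootSpace H α.1) (hy : y ∈ rootSpace H β.1) : ⁅x, y⁆ = 0 := by
  have hxy : ⁅x, y⁆ ∈ rootSpace H ((α.1 : H → ℝ) + β.1) :=
    lie_mem_genWeightSpace_of_mem_genWeightSpace hx hy
  by_cases hbot : rootSpace H ((α.1 : H → ℝ) + β.1) = ⊥
  · rw [hbot] at hxy
    exact (LieSubmodule.mem_bot _).mp hxy
  · exfalso
    let γ : LieModule.Weight ℝ H g₀ := ⟨(α.1 : H → ℝ) + β.1, hbot⟩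
    have hγ : γ.IsNonZero := by
      intro hz
      have hz' : (α.1 : H → ℝ) + β.1 = 0 := hz
      apply h0
      ext x
      exact eq_neg_of_add_eq_zero_left (congrFun hz' x)
    have hγ' : γ ∈ H.root := by simpa using hγ
    exact h ⟨⟨γ, hγ'⟩, root_add_iff.mpr rfl⟩

/-- The Killing form pairs the root spaces of α and -α non-degenerately. With this normalization,
pairing with f reads off the coefficient of e. -/
theorem exists_rootVec (α : H.root) : ∃ e ∈ rootSpace H α.1, ∃ f ∈ rootSpace H (-(α.1 : H → ℝ)),
    killingForm ℝ g₀ f e = 1 := by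
  obtain ⟨e, he, he0⟩ := α.1.exists_ne_zero
  have hker : e ∉ LinearMap.ker (killingForm ℝ g₀) := by
    rw [IsKilling.ker_killingForm_eq_bot]
    simpa using he0
  have := mt (mem_ker_killingForm_of_mem_rootSpace_of_forall_rootSpace_neg ℝ g₀ H he) hker
  push Not at this
  obtain ⟨f, hf, hef⟩ := this
  refine ⟨e, he, (killingForm ℝ g₀ e f)⁻¹ • f, Submodule.smul_mem _ _ hf, ?_⟩
  rw [map_smul, LinearMap.smul_apply, smul_eq_mul,
    show killingForm ℝ g₀ f e = killingForm ℝ g₀ e f from LieModule.traceForm_comm ℝ g₀ g₀ f e,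
    inv_mul_cancel₀ hef]

/-- A nonzero vector in the root space of `α`. -/
def rootVec (α : H.root) : g₀ := (exists_rootVec α).choose

theorem rootVec_mem (α : H.root) : rootVec α ∈ rootSpace H α.1 :=
  (exists_rootVec α).choose_spec.1

/-- The coordinate with respect to `rootVec α` along the other root spaces and `H`. -/
def rootCoord (α : H.root) : Module.Dual ℝ g₀ :=
  killingForm ℝ g₀ (exists_rootVec α).choose_spec.2.choose

theorem rootCoord_rootVec_self (α : H.root) : rootCoord α (rootVec α) = 1 :=
  (exists_rootVec α).choose_spec.2.choose_spec.2

theorem rootCoord_eq_zero {α : H.root} {χ : H → ℝ} (h : χ ≠ α.1) {x : g₀}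
    (hx : x ∈ rootSpace H χ) : rootCoord α x = 0 := by
  refine killingForm_apply_eq_zero_of_mem_rootSpace_of_add_ne_zero ℝ g₀ H
    (exists_rootVec α).choose_spec.2.choose_spec.1 hx fun h0 => h ?_
  exact (eq_of_sub_eq_zero (by rw [← h0]; abel))

omit [IsSemisimple ℝ g₀] [LieModule.IsTriangularizable ℝ H g₀] in
theorem coe_ne_of_ne {α β : H.root} (h : β ≠ α) : (β.1 : H → ℝ) ≠ α.1 := fun h' =>
  h (Subtype.ext (DFunLike.coe_injective h'))

theorem rootCoord_rootVec_of_ne {α β : H.root} (h : β ≠ α) : rootCoord α (rootVec β) = 0 :=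
  rootCoord_eq_zero (coe_ne_of_ne h) (rootVec_mem β)

theorem rootVec_ne_zero (α : H.root) : rootVec α ≠ 0 := fun h => by
  have := rootCoord_rootVec_self α
  rw [h, map_zero] at this
  exact zero_ne_one this

omit [IsSemisimple ℝ g₀] [LieModule.IsTriangularizable ℝ H g₀] in
theorem coe_root_ne_zero (α : H.root) : (0 : H → ℝ) ≠ α.1 := fun h =>
  H.isNonZero_coe_root α h.symm

theorem rootCoord_of_mem_cartan (α : H.root) {x : g₀} (hx : x ∈ H) : rootCoord α x = 0 :=
  rootCoord_eq_zero (coe_root_ne_zero α)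
    (toLieSubmodule_le_rootSpace_zero ℝ g₀ H (show x ∈ H.toLieSubmodule from hx))

theorem eq_smul_rootVec {α : H.root} {x : g₀} (hx : x ∈ rootSpace H α.1) :
    x = rootCoord α x • rootVec α := by
  obtain ⟨c, hc⟩ := (finrank_eq_one_iff_of_nonzero' (⟨rootVec α, rootVec_mem α⟩ : rootSpace H α.1)
    (fun h => rootVec_ne_zero α (congrArg Subtype.val h))).mp
    (finrank_rootSpace_eq_one α.1 (H.isNonZero_coe_root α)) ⟨x, hx⟩
  have hc' : c • rootVec α = x := congrArg Subtype.val hc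
  rw [← hc', map_smul, rootCoord_rootVec_self, smul_eq_mul, mul_one]

theorem exists_eq_add_sum (x : g₀) : ∃ h ∈ H, x = h + ∑ α : H.root, rootCoord α x • rootVec α := by
  have hx : x ∈ H.toLieSubmodule ⊔ ⨆ α : Weight ℝ H g₀, ⨆ (_ : α.IsNonZero), rootSpace H α := by
    rw [cartan_sup_iSup_rootSpace_eq_top]; trivial
  obtain ⟨h, hh, y, hy, rfl⟩ := Submodule.mem_sup.mp hx
  refine ⟨h, hh, ?_⟩
  simp only [map_add, rootCoord_of_mem_cartan _ hh, zero_add]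
  congr 1
  have hy' : y ∈ ⨆ α : H.root, (rootSpace H α.1).toSubmodule := by
    have : (⨆ α : Weight ℝ H g₀, ⨆ (_ : α.IsNonZero), rootSpace H α).toSubmodule ≤
        ⨆ α : H.root, (rootSpace H α.1).toSubmodule := by
      simp only [LieSubmodule.iSup_toSubmodule]
      refine iSup₂_le fun α hα => ?_
      exact le_iSup (fun α : H.root => (rootSpace H α.1).toSubmodule) ⟨α, by simpa using hα⟩
    exact this hy
  clear hy hx
  induction hy' using Submodule.iSup_induction' with
  | mem α y hy =>
    rw [Finset.sum_eq_single α, ← eq_smul_rootVec hy]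
    · intro β _ hβ
      rw [rootCoord_eq_zero (coe_ne_of_ne hβ.symm) hy, zero_smul]
    · simp
  | zero => simp
  | add y z _ _ hy hz =>
    simp only [map_add, add_smul, Finset.sum_add_distrib]
    rw [← hy, ← hz]

theorem rootCoord_sum (c : H.root → ℝ) (α : H.root) :
    rootCoord α (∑ β : H.root, c β • rootVec β) = c α := by
  rw [map_sum, Finset.sum_eq_single α]
  · rw [map_smul, rootCoord_rootVec_self, smul_eq_mul, mul_one]
  · intro β _ hβ
    rw [map_smul, rootCoord_rootVec_of_ne hβ, smul_zero]
  · simp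

variable (H) in
theorem finrank_eq_finrank_add_card :
    Module.finrank ℝ g₀ = Module.finrank ℝ H + Fintype.card H.root := by
  let f : g₀ →ₗ[ℝ] (H.root → ℝ) := LinearMap.pi rootCoord
  have hsurj : LinearMap.range f = ⊤ := by
    rw [LinearMap.range_eq_top]
    exact fun c => ⟨∑ β : H.root, c β • rootVec β, funext fun α => rootCoord_sum c α⟩
  have hker : LinearMap.ker f = H.toSubmodule := by
    ext x
    constructor
    · intro hx
      obtain ⟨h, hh, hxh⟩ := exists_eq_add_sum (H := H) x
      have h0 : ∀ α : H.root, rootCoord α x = 0 := fun α => congrFun hx α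
      rw [hxh]
      simpa [h0] using hh
    · intro hx
      exact LinearMap.mem_ker.mpr (funext fun α => rootCoord_of_mem_cartan α hx)
  have := f.finrank_range_add_finrank_ker
  rw [hsurj, hker, finrank_top, Module.finrank_fintype_fun_eq_card] at this
  rw [← this, add_comm]
  rfl

/-- The bracket of the root spaces of `α` and `β` is nonzero if `α + β` is a root. -/
theorem lie_ne_zero_of_root_eq_add {α β γ : H.root}
    (hγ : (rootSystem H).root γ = (rootSystem H).root α + (rootSystem H).root β) {x y : g₀}
    (hx : x ∈ rootSpace H α.1) (hy : y ∈ rootSpace H β.1) (hx0 : x ≠ 0) (hy0 : y ≠ 0) :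
    ⁅x, y⁆ ≠ 0 := by
  have hα := H.isNonZero_coe_root α
  obtain ⟨w, hw, hw0⟩ := (chainTop α.1 β.1).exists_ne_zero
  obtain ⟨hh, e, f, ht, he, hf⟩ := exists_isSl2Triple_of_weight_isNonZero hα
  obtain rfl := ht.h_eq_coroot hα he hf
  have prim : ht.HasPrimitiveVectorWith w (chainLength α.1 β.1 : ℝ) :=
    have := lie_mem_genWeightSpace_of_mem_genWeightSpace he hw
    ⟨hw0, (chainLength_smul _ _ hw).symm, by rwa [genWeightSpace_add_chainTop _ _ hα] at this⟩
  -- As α + β is a root, β is not the top of its α-chain.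
  have hq0 : chainTopCoeff (α.1 : H → ℝ) β.1 ≠ 0 := by
    intro h0
    have h1 := genWeightSpace_add_chainTop (α.1 : H → ℝ) β.1 hα
    rw [coe_chainTop, h0, Nat.cast_zero, zero_smul, zero_add, ← root_add_iff.mp hγ] at h1
    exact γ.1.2 h1
  obtain ⟨q, hq⟩ := Nat.exists_eq_succ_of_ne_zero hq0
  have hqN : q + 1 ≤ chainLength α.1 β.1 := by
    have := chainTopCoeff_le_chainLength α.1 β.1
    omega
  -- With w at the top of the chain and N its length, f^(q+1) w has weight β, and e sends it to (q +
  -- 1)(N - q) f^q w, which is nonzero since q < N.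
  have h1 := prim.lie_e_pow_succ_toEnd_f q
  have h2 : ((LieModule.toEnd ℝ g₀ g₀ f) ^ (q + 1)) w ∈ rootSpace H β.1 := by
    have := toEnd_pow_apply_mem hf hw (q + 1)
    rw [coe_chainTop, hq] at this
    convert this using 2
    ext t
    simp
  have h3 : ⁅e, ((LieModule.toEnd ℝ g₀ g₀ f) ^ (q + 1)) w⁆ ≠ 0 := by
    rw [h1]
    refine smul_ne_zero (mul_ne_zero (by positivity) ?_)
      (prim.pow_toEnd_f_ne_zero_of_eq_nat rfl (by omega))
    have : (q : ℝ) + 1 ≤ chainLength α.1 β.1 := by exact_mod_cast hqN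
    intro h
    linarith
  intro hxy
  have hx' := eq_smul_rootVec hx
  have hy' := eq_smul_rootVec hy
  rw [hx', hy', smul_lie, lie_smul] at hxy
  have hcx : rootCoord α x ≠ 0 := fun h => hx0 (by rw [hx', h, zero_smul])
  have hcy : rootCoord β y ≠ 0 := fun h => hy0 (by rw [hy', h, zero_smul])
  -- Root spaces are lines, so one vanishing bracket of nonzero vectors would make all brackets of
  -- the two root spaces vanish.
  have h4 : ⁅rootVec α, rootVec β⁆ = 0 := by
    simpa [hcx, hcy] using hxy
  rw [eq_smul_rootVec he, eq_smul_rootVec h2, smul_lie, lie_smul, h4, smul_zero, smul_zero] at h3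
  exact h3 rfl

end RootVectors

/-! ### The nilradical of the minimal parabolic subalgebra -/

section PositivePart

open LieAlgebra LieAlgebra.IsKilling LieModule

variable {g₀ : Type*} [LieRing g₀] [LieAlgebra ℝ g₀] [FiniteDimensional ℝ g₀]
  [IsSemisimple ℝ g₀] {H : LieSubalgebra ℝ g₀} [H.IsCartanSubalgebra]
  [LieModule.IsTriangularizable ℝ H g₀] (b : (rootSystem H).Base)

/-- The sum of the root spaces of height larger than `k`. -/
def heightGT (k : ℤ) : Submodule ℝ g₀ :=
  ⨆ α : {α : H.root // k < b.height α}, (rootSpace H α.1.1).toSubmodule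

/-- The sum of the positive root spaces. -/
def nPlus : Submodule ℝ g₀ := ⨆ α : {α : H.root // b.IsPos α}, (rootSpace H α.1.1).toSubmodule

theorem mem_minimalParabolic {x : g₀} :
    x ∈ minimalParabolic b ↔ x ∈ H.toSubmodule ⊔ nPlus b := Iff.rfl

variable {b}

theorem mem_heightGT_of_mem_rootSpace {k : ℤ} {α : H.root} (hα : k < b.height α) {x : g₀}
    (hx : x ∈ rootSpace H α.1) : x ∈ heightGT b k :=
  Submodule.mem_iSup_of_mem (p := fun α : {α : H.root // k < b.height α} =>
    (rootSpace H α.1.1).toSubmodule) ⟨α, hα⟩ hx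

theorem rootVec_mem_nPlus {α : H.root} (hα : b.IsPos α) : rootVec α ∈ nPlus b :=
  mem_heightGT_of_mem_rootSpace hα (rootVec_mem α)

/-- Heights are integers, so the sum exceeds j + k + 1. The extra 1 makes bracketing with positive
root spaces (j = 0) strictly raise the bound, whence nilpotency. -/
theorem lie_mem_heightGT {j k : ℤ} (hj : 0 ≤ j) (hk : 0 ≤ k) {x y : g₀} (hx : x ∈ heightGT b j)
    (hy : y ∈ heightGT b k) : ⁅x, y⁆ ∈ heightGT b (j + k + 1) := by
  induction hx using Submodule.iSup_induction' with
  | mem α x hx =>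
    induction hy using Submodule.iSup_induction' with
    | mem β y hy =>
      by_cases h : (rootSystem H).root α.1 + (rootSystem H).root β.1 ∈
          Set.range (rootSystem H).root
      · obtain ⟨γ, hγ⟩ := h
        refine mem_heightGT_of_mem_rootSpace (α := γ) ?_
          (lie_mem_rootSpace_of_root_eq_add hγ hx hy)
        have := b.height_add hγ
        have := α.2
        have := β.2
        omega
      · rw [lie_eq_zero_of_add_notMem ?_ h hx hy]
        · exact zero_mem _
        · intro h0
          obtain ⟨γ, hγ, hγp⟩ := exists_root_eq_neg b β.1
          have e : α.1 = γ := (rootSystem H).root.injective (by rw [h0, hγ])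
          have h1 : b.IsPos β.1 := lt_of_le_of_lt hk β.2
          have h2 : b.IsPos α.1 := lt_of_le_of_lt hj α.2
          exact hγp.mp (e ▸ h2) h1
    | zero => simp
    | add y z _ _ hy hz => rw [lie_add]; exact add_mem hy hz
  | zero => simp
  | add x z _ _ hx hz => rw [add_lie]; exact add_mem hx hz

theorem heightGT_anti {j k : ℤ} (h : j ≤ k) : heightGT b k ≤ heightGT b j :=
  iSup_le fun α _ hx => mem_heightGT_of_mem_rootSpace (lt_of_le_of_lt h α.2) hx

theorem lie_mem_nPlus {x y : g₀} (hx : x ∈ nPlus b) (hy : y ∈ nPlus b) : ⁅x, y⁆ ∈ nPlus b :=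
  heightGT_anti (by omega) (lie_mem_heightGT le_rfl le_rfl hx hy)

theorem cartan_lie_mem_nPlus {h y : g₀} (hh : h ∈ H) (hy : y ∈ nPlus b) : ⁅h, y⁆ ∈ nPlus b := by
  induction hy using Submodule.iSup_induction' with
  | mem α y hy =>
    exact Submodule.mem_iSup_of_mem (p := fun α : {α : H.root // b.IsPos α} =>
      (rootSpace H α.1.1).toSubmodule) α ((rootSpace H α.1.1).lie_mem (x := ⟨h, hh⟩) hy)
  | zero => simp
  | add y z _ _ hy hz => rw [lie_add]; exact add_mem hy hz

variable (b) in
theorem exists_heightGT_eq_bot : ∃ k : ℕ, heightGT b k = ⊥ := by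
  obtain ⟨k, hk⟩ := (Set.finite_range b.height).bddAbove
  refine ⟨k.toNat, ?_⟩
  rw [heightGT, iSup_eq_bot]
  rintro ⟨α, hα⟩
  have := hk ⟨α, rfl⟩
  omega

theorem rootCoord_eq_zero_of_mem_nPlus {α : H.root} (hα : ¬ b.IsPos α) {x : g₀}
    (hx : x ∈ nPlus b) : rootCoord α x = 0 := by
  induction hx using Submodule.iSup_induction' with
  | mem β x hx =>
    refine rootCoord_eq_zero (coe_ne_of_ne ?_) hx
    intro h
    exact hα (h ▸ β.2)
  | zero => simp
  | add y z _ _ hy hz => rw [map_add, hy, hz, add_zero]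

theorem eq_sum_of_mem_nPlus {x : g₀} (hx : x ∈ nPlus b) :
    x = ∑ α : H.root, rootCoord α x • rootVec α := by
  induction hx using Submodule.iSup_induction' with
  | mem α y hy =>
    rw [Finset.sum_eq_single α.1, ← eq_smul_rootVec hy]
    · intro β _ hβ
      rw [rootCoord_eq_zero (coe_ne_of_ne hβ.symm) hy, zero_smul]
    · simp
  | zero => simp
  | add y z _ _ hy hz =>
    simp only [map_add, add_smul, Finset.sum_add_distrib]
    rw [← hy, ← hz]

theorem eq_of_rootCoord_eq {x y : g₀} (hx : x ∈ nPlus b) (hy : y ∈ nPlus b)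
    (h : ∀ α, b.IsPos α → rootCoord α x = rootCoord α y) : x = y := by
  rw [eq_sum_of_mem_nPlus hx, eq_sum_of_mem_nPlus hy]
  refine Finset.sum_congr rfl fun α _ => ?_
  by_cases hα : b.IsPos α
  · rw [h α hα]
  · rw [rootCoord_eq_zero_of_mem_nPlus hα hx, rootCoord_eq_zero_of_mem_nPlus hα hy]

variable (b) in
open Classical in
theorem finrank_nPlus :
    Module.finrank ℝ (nPlus b) = (Finset.univ.filter fun α => b.IsPos α).card := by
  let f : nPlus b →ₗ[ℝ] ({α : H.root // b.IsPos α} → ℝ) :=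
    LinearMap.pi fun α => rootCoord α.1 ∘ₗ (nPlus b).subtype
  have hinj : Function.Injective f := fun x y h => Subtype.ext
    (eq_of_rootCoord_eq x.2 y.2 fun α hα => congrFun h ⟨α, hα⟩)
  have hsurj : Function.Surjective f := fun c => by
    let c' : H.root → ℝ := fun α => if h : b.IsPos α then c ⟨α, h⟩ else 0
    refine ⟨⟨∑ α : H.root, c' α • rootVec α, ?_⟩, ?_⟩
    · refine sum_mem fun α _ => ?_
      by_cases h : b.IsPos α
      · exact Submodule.smul_mem _ _ (rootVec_mem_nPlus h)
      · simp [c', h]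
    · ext α
      change rootCoord α.1 (∑ β : H.root, c' β • rootVec β) = c α
      rw [rootCoord_sum]
      simp [c', α.2]
  rw [(LinearEquiv.ofBijective f ⟨hinj, hsurj⟩).finrank_eq, Module.finrank_fintype_fun_eq_card,
    Fintype.card_subtype]

/-- A Lie algebra embedding in the positive part is nilpotent. -/
theorem isNilpotent_of_injective {L : Type*} [LieRing L] [LieAlgebra ℝ L] (φ : L →ₗ⁅ℝ⁆ g₀)
    (hφ : Function.Injective φ) (hr : ∀ x, φ x ∈ nPlus b) : LieRing.IsNilpotent L := by
  have key : ∀ k : ℕ, ∀ x ∈ LieModule.lowerCentralSeries ℝ L L k, φ x ∈ heightGT b k := by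
    intro k
    induction k with
    | zero => exact fun x _ => hr x
    | succ k ih =>
      intro x hx
      rw [← LieSubmodule.mem_toSubmodule, LieModule.lowerCentralSeries_succ,
        LieSubmodule.lieIdeal_oper_eq_linear_span'] at hx
      induction hx using Submodule.span_induction with
      | mem c hc =>
        obtain ⟨x, -, n, hn, rfl⟩ := hc
        rw [LieHom.map_lie]
        have := lie_mem_heightGT le_rfl (Int.natCast_nonneg k) (hr x) (ih n hn)
        rwa [zero_add] at this
      | zero => simp
      | add c c' _ _ h h' => rw [map_add]; exact add_mem h h'
      | smul a c _ h => rw [map_smul]; exact Submodule.smul_mem _ _ h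
  obtain ⟨k, hk⟩ := exists_heightGT_eq_bot b
  rw [LieRing.IsNilpotent, LieModule.isNilpotent_iff ℝ]
  refine ⟨k, (LieSubmodule.eq_bot_iff _).mpr fun x hx => hφ ?_⟩
  have := key k x hx
  rw [hk, Submodule.mem_bot] at this
  rw [this, map_zero]

variable (b) in
/-- The sum of the positive root spaces as an ideal of the minimal parabolic subalgebra. -/
def nPlusIdeal : LieIdeal ℝ (minimalParabolic b) where
  __ := (nPlus b).comap (minimalParabolic b).toSubmodule.subtype
  lie_mem := by
    intro x y hy
    obtain ⟨h, hh, u, hu, hx⟩ := Submodule.mem_sup.mp ((mem_minimalParabolic b).mp x.2)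
    change ⁅(x : g₀), (y : g₀)⁆ ∈ nPlus b
    have hy' : (y : g₀) ∈ nPlus b := hy
    rw [← hx, add_lie]
    exact add_mem (cartan_lie_mem_nPlus hh hy') (lie_mem_nPlus hu hy')

theorem nPlusIdeal_le_nilradical : nPlusIdeal b ≤ nilradical (minimalParabolic b) := by
  refine le_sSup ?_
  refine isNilpotent_of_injective (b := b)
    ((minimalParabolic b).incl.comp (nPlusIdeal b).incl) ?_ fun x => x.2
  exact Subtype.val_injective.comp Subtype.val_injective

theorem eq_zero_of_mem_cartan {h : H} (hh : ∀ α : H.root, b.IsPos α → α.1 h = 0) : h = 0 := by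
  have : h ∈ ⨅ α : Weight ℝ H g₀, α.ker := by
    refine (Submodule.mem_iInf _).mpr fun χ => ?_
    rw [LinearMap.mem_ker]
    change χ h = 0
    by_cases hχ : χ.IsNonZero
    · by_cases hp : b.IsPos ⟨χ, by simpa using hχ⟩
      · exact hh _ hp
      · obtain ⟨γ, hγ, hγp⟩ := exists_root_eq_neg b (⟨χ, by simpa using hχ⟩ : H.root)
        have h1 := hh γ (hγp.mpr hp)
        have h2 : γ.1 h = - χ h := LinearMap.congr_fun hγ h
        rw [h2, neg_eq_zero] at h1
        exact h1
    · simp only [Weight.IsNonZero, not_not] at hχ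
      exact congrFun hχ h
  simpa [iInf_ker_weight_eq_bot] using this

theorem mem_or_of_mem_rootSpace {χ : Weight ℝ H g₀} {x : g₀} (hx : x ∈ rootSpace H χ)
    (hxp : x ∈ minimalParabolic b) : x ∈ nPlus b ∨ x ∈ H := by
  by_cases hχ : χ.IsNonZero
  · left
    obtain ⟨h, hh, u, hu, hxu⟩ := Submodule.mem_sup.mp ((mem_minimalParabolic b).mp hxp)
    let α : H.root := ⟨χ, by simpa using hχ⟩
    by_cases hp : b.IsPos α
    · exact mem_heightGT_of_mem_rootSpace (α := α) hp hx
    · have h1 : rootCoord α x = 0 := by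
        rw [← hxu, map_add, rootCoord_of_mem_cartan α hh, rootCoord_eq_zero_of_mem_nPlus hp hu,
          add_zero]
      have h2 := eq_smul_rootVec (α := α) hx
      rw [h1, zero_smul] at h2
      rw [h2]
      exact zero_mem _
  · right
    simp only [Weight.IsNonZero, not_not] at hχ
    have h1 : rootSpace H (χ : H → ℝ) = H.toLieSubmodule := by
      rw [show (χ : H → ℝ) = 0 from hχ]; simp
    rw [h1] at hx
    simpa using hx

/-- The ideal is stable under the Cartan subalgebra and splits into weight parts, so only an element
x of I in H could escape. If α(x) ≠ 0 for a positive α, then e_α is a multiple of [x, e_α] and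
survives in every term of the lower central series of I. So all positive roots kill x, and x = 0. -/
theorem le_nPlusIdeal_of_isNilpotent (I : LieIdeal ℝ (minimalParabolic b))
    (hI : LieRing.IsNilpotent I) : I ≤ nPlusIdeal b := by
  have hHp : ∀ h ∈ H, h ∈ minimalParabolic b := fun h hh => Submodule.mem_sup_left hh
  let N : LieSubmodule ℝ H g₀ :=
    { I.toSubmodule.map (minimalParabolic b).toSubmodule.subtype with
      lie_mem := by
        rintro h _ ⟨y, hy, rfl⟩
        exact ⟨⁅(⟨h, hHp h h.2⟩ : minimalParabolic b), y⁆, I.lie_mem hy, rfl⟩ }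
  have hN : ∀ x ∈ N, ∃ hx : x ∈ minimalParabolic b, (⟨x, hx⟩ : minimalParabolic b) ∈ I := by
    rintro _ ⟨y, hy, rfl⟩
    exact ⟨y.2, hy⟩
  have key : (N : Submodule ℝ g₀) ≤ nPlus b := by
    have hNdec : N = ⨆ χ : Weight ℝ H g₀, N ⊓ genWeightSpace g₀ χ := 
      eq_iSup_inf_genWeightSpace ℝ H g₀ N
    rw [hNdec, LieSubmodule.iSup_toSubmodule]
    refine iSup_le fun χ x hx => ?_
    obtain ⟨hxN, hxχ⟩ : x ∈ N ∧ x ∈ genWeightSpace g₀ χ := (LieSubmodule.mem_inf _ _ _).mp hx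
    obtain ⟨hxp, hxI⟩ := hN x hxN
    rcases mem_or_of_mem_rootSpace hxχ hxp with h | h
    · exact h
    suffices (⟨x, h⟩ : H) = 0 by
      have : x = 0 := congrArg Subtype.val this
      rw [this]; exact zero_mem _
    refine eq_zero_of_mem_cartan (b := b) fun α hα => ?_
    by_contra hne
    have hep : rootVec α ∈ minimalParabolic b := Submodule.mem_sup_right (rootVec_mem_nPlus hα)
    have hlie : ⁅x, rootVec α⁆ = α.1 (⟨x, h⟩ : H) • rootVec α :=
      lie_eq_smul_of_mem_rootSpace (rootVec_mem α) (⟨x, h⟩ : H)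
    have hlie' : (⟨rootVec α, hep⟩ : minimalParabolic b) =
        (α.1 (⟨x, h⟩ : H))⁻¹ • ⁅(⟨x, hxp⟩ : minimalParabolic b), ⟨rootVec α, hep⟩⁆ := by
      ext1
      change rootVec α = (α.1 (⟨x, h⟩ : H))⁻¹ • ⁅x, rootVec α⁆
      rw [hlie, smul_smul, inv_mul_cancel₀ hne, one_smul]
    have heI : (⟨rootVec α, hep⟩ : minimalParabolic b) ∈ I := by
      rw [hlie']
      exact Submodule.smul_mem _ _ (lie_mem_left ℝ _ I _ _ hxI)
    have hlcs : ∀ k, (⟨⟨rootVec α, hep⟩, heI⟩ : I) ∈ LieModule.lowerCentralSeries ℝ I I k := by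
      intro k
      induction k with
      | zero => simp
      | succ k ih =>
        have : (⟨⟨rootVec α, hep⟩, heI⟩ : I) = (α.1 (⟨x, h⟩ : H))⁻¹ •
            ⁅(⟨⟨x, hxp⟩, hxI⟩ : I), (⟨⟨rootVec α, hep⟩, heI⟩ : I)⁆ := Subtype.ext hlie'
        rw [this, LieModule.lowerCentralSeries_succ]
        exact Submodule.smul_mem _ _ (LieSubmodule.lie_mem_lie (LieSubmodule.mem_top _) ih)
    obtain ⟨k, hk⟩ := (LieModule.isNilpotent_iff ℝ I I).mp hI
    have := hlcs k
    rw [hk, LieSubmodule.mem_bot] at this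
    exact rootVec_ne_zero α (congrArg (fun y : I => ((y : minimalParabolic b) : g₀)) this)
  intro x hx
  exact key ⟨x, hx, rfl⟩

variable (b) in
theorem nilradical_minimalParabolic : nilradical (minimalParabolic b) = nPlusIdeal b :=
  le_antisymm (sSup_le fun I hI => le_nPlusIdeal_of_isNilpotent I hI) nPlusIdeal_le_nilradical

variable (b) in
/-- The inclusion of the nilradical of the minimal parabolic subalgebra. -/
def nilradicalIncl : nilradical (minimalParabolic b) →ₗ⁅ℝ⁆ g₀ :=
  (minimalParabolic b).incl.comp (nilradical (minimalParabolic b)).incl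

theorem nilradicalIncl_injective : Function.Injective (nilradicalIncl b) :=
  Subtype.val_injective.comp Subtype.val_injective

theorem range_nilradicalIncl (x : g₀) : x ∈ nPlus b ↔ ∃ y, nilradicalIncl b y = x := by
  constructor
  · intro hx
    have hxp : x ∈ minimalParabolic b := Submodule.mem_sup_right hx
    have : (⟨x, hxp⟩ : minimalParabolic b) ∈ nilradical (minimalParabolic b) := by
      rw [nilradical_minimalParabolic]
      exact hx
    exact ⟨⟨_, this⟩, rfl⟩
  · rintro ⟨y, rfl⟩
    exact (nilradical_minimalParabolic b).le y.2

end PositivePart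

/-! ### Symplectic forms from explicit bases -/

section Bases

variable {L : Type*} [LieRing L] [LieAlgebra ℝ L]

theorem isSymplectic_trivExt_of_heisenberg_basis {X Y Z : Module.Dual ℝ L} {x y z : L}
    (hexp : ∀ a, a = X a • x + Y a • y + Z a • z)
    (hxy : ⁅x, y⁆ = z) (hxz : ⁅x, z⁆ = 0) (hyz : ⁅y, z⁆ = 0)
    (hx : X x = 1 ∧ Y x = 0 ∧ Z x = 0) (hy : X y = 0 ∧ Y y = 1 ∧ Z y = 0)
    (hz : X z = 0 ∧ Y z = 0 ∧ Z z = 1) {s : ℕ} (hs : Odd s) :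
    IsSymplectic (TrivExt L s) := by
  have hyx : ⁅y, x⁆ = -z := by rw [← lie_skew, hxy]
  have hzx : ⁅z, x⁆ = 0 := by rw [← lie_skew, hxz, neg_zero]
  have hzy : ⁅z, y⁆ = 0 := by rw [← lie_skew, hyz, neg_zero]
  have key : ∀ a b : L, ⁅a, b⁆ = (X a * Y b - X b * Y a) • z := fun a b => by
    calc ⁅a, b⁆ = ⁅X a • x + Y a • y + Z a • z, X b • x + Y b • y + Z b • z⁆ := by
          rw [← hexp a, ← hexp b]
      _ = (X a * Y b - X b * Y a) • z := by
          simp only [add_lie, lie_add, smul_lie, lie_smul, hxy, hxz, hyz, hyx, hzx, hzy, lie_self,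
            smul_zero, add_zero, zero_add]
          module
  refine isSymplectic_trivExt_of_heisenberg (X := X) (Y := Y) (Z := Z) (fun a b => ?_)
    (fun a b => ?_) (fun a b => ?_) hx hy hz (fun a h1 h2 h3 => ?_) hs
  · rw [key, map_smul, hz.1, smul_zero]
  · rw [key, map_smul, hz.2.1, smul_zero]
  · rw [key, map_smul, hz.2.2, smul_eq_mul, mul_one]
  · rw [hexp a, h1, h2, h3]; simp

theorem isSymplectic_trivExt_of_filiform_basis {X Y U V : Module.Dual ℝ L} {x y u v : L}
    (hexp : ∀ a, a = X a • x + Y a • y + U a • u + V a • v)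
    (hxy : ⁅x, y⁆ = u) (hxu : ⁅x, u⁆ = v) (hxv : ⁅x, v⁆ = 0) (hyu : ⁅y, u⁆ = 0)
    (hyv : ⁅y, v⁆ = 0) (huv : ⁅u, v⁆ = 0)
    (hx : X x = 1 ∧ Y x = 0 ∧ U x = 0 ∧ V x = 0) (hy : X y = 0 ∧ Y y = 1 ∧ U y = 0 ∧ V y = 0)
    (hu : X u = 0 ∧ Y u = 0 ∧ U u = 1 ∧ V u = 0) (hv : X v = 0 ∧ Y v = 0 ∧ U v = 0 ∧ V v = 1)
    {s : ℕ} (hs : Even s) : IsSymplectic (TrivExt L s) := by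
  have hyx : ⁅y, x⁆ = -u := by rw [← lie_skew, hxy]
  have hux : ⁅u, x⁆ = -v := by rw [← lie_skew, hxu]
  have hvx : ⁅v, x⁆ = 0 := by rw [← lie_skew, hxv, neg_zero]
  have huy : ⁅u, y⁆ = 0 := by rw [← lie_skew, hyu, neg_zero]
  have hvy : ⁅v, y⁆ = 0 := by rw [← lie_skew, hyv, neg_zero]
  have hvu : ⁅v, u⁆ = 0 := by rw [← lie_skew, huv, neg_zero]
  have key : ∀ a b : L, ⁅a, b⁆ = (X a * Y b - X b * Y a) • u + (X a * U b - X b * U a) • v :=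
    fun a b => by
    calc ⁅a, b⁆ = ⁅X a • x + Y a • y + U a • u + V a • v,
            X b • x + Y b • y + U b • u + V b • v⁆ := by
          rw [← hexp a, ← hexp b]
      _ = (X a * Y b - X b * Y a) • u + (X a * U b - X b * U a) • v := by
          simp only [add_lie, lie_add, smul_lie, lie_smul, hxy, hxu, hxv, hyu, hyv, huv, hyx, hux,
            hvx, huy, hvy, hvu, lie_self, smul_zero, add_zero, zero_add]
          module
  refine isSymplectic_trivExt_of_filiform (X := X) (Y := Y) (U := U) (V := V) (fun a b => ?_)
    (fun a b => ?_) (fun a b => ?_) (fun a b => ?_) hx hy hu hv (fun a h1 h2 h3 h4 => ?_) hs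
  · rw [key, map_add, map_smul, map_smul, hu.1, hv.1]; simp
  · rw [key, map_add, map_smul, map_smul, hu.2.1, hv.2.1]; simp
  · rw [key, map_add, map_smul, map_smul, hu.2.2.1, hv.2.2.1]; simp
  · rw [key, map_add, map_smul, map_smul, hu.2.2.2, hv.2.2.2]; simp
  · rw [hexp a, h1, h2, h3, h4]; simp

end Bases

/-! ### Closed two-forms on the positive part -/

section PositiveNilpotent

open LieAlgebra LieAlgebra.IsKilling LieModule

variable {g₀ : Type*} [LieRing g₀] [LieAlgebra ℝ g₀] [FiniteDimensional ℝ g₀]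
  [IsSemisimple ℝ g₀] {H : LieSubalgebra ℝ g₀} [H.IsCartanSubalgebra]
  [LieModule.IsTriangularizable ℝ H g₀] {b : (rootSystem H).Base}
  {L : Type*} [LieRing L] [LieAlgebra ℝ L] {φ : L →ₗ⁅ℝ⁆ g₀}
  (hφ : Function.Injective φ) (hr : ∀ x, x ∈ nPlus b ↔ ∃ y, φ y = x)

include hφ hr in
open Classical in
theorem finrank_eq_card_isPos :
    Module.finrank ℝ L = (Finset.univ.filter fun α => b.IsPos α).card := by
  have h : LinearMap.range (φ : L →ₗ[ℝ] g₀) = nPlus b := by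
    ext x
    exact (hr x).symm
  rw [← finrank_nPlus b, ← h]
  exact (LinearEquiv.ofInjective (φ : L →ₗ[ℝ] g₀) hφ).finrank_eq

include hr in
theorem exists_posVec : ∃ e : H.root → L, ∀ α, b.IsPos α → φ (e α) = rootVec α := by
  choose e he using fun (α : H.root) (h : b.IsPos α) => (hr _).mp (rootVec_mem_nPlus h)
  classical
  exact ⟨fun α => if h : b.IsPos α then e α h else 0, fun α h => by simp only [dif_pos h, he]⟩

variable (φ) in
/-- The coordinates on a Lie algebra embedded in the positive part. -/
def posCoord (α : H.root) : Module.Dual ℝ L := rootCoord α ∘ₗ (φ : L →ₗ[ℝ] g₀)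

theorem posCoord_apply (α : H.root) (a : L) : posCoord φ α a = rootCoord α (φ a) := rfl

variable {e : H.root → L} (he : ∀ α, b.IsPos α → φ (e α) = rootVec α)

include he in
theorem posCoord_posVec_self {α : H.root} (hα : b.IsPos α) : posCoord φ α (e α) = 1 := by
  rw [posCoord_apply, he α hα, rootCoord_rootVec_self]

include he in
theorem posCoord_posVec_of_ne {α β : H.root} (hβ : b.IsPos β) (h : β ≠ α) :
    posCoord φ α (e β) = 0 := by
  rw [posCoord_apply, he β hβ, rootCoord_rootVec_of_ne h]

include hφ hr he in
open Classical in
theorem eq_sum_posCoord (a : L) :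
    a = ∑ α ∈ Finset.univ.filter fun α => b.IsPos α, posCoord φ α a • e α := by
  apply hφ
  have ha : φ a ∈ nPlus b := (hr _).mpr ⟨a, rfl⟩
  conv_lhs => rw [eq_sum_of_mem_nPlus ha]
  rw [map_sum, Finset.sum_filter]
  refine Finset.sum_congr rfl fun α _ => ?_
  split_ifs with h
  · rw [map_smul, he α h, posCoord_apply]
  · rw [rootCoord_eq_zero_of_mem_nPlus h ha, zero_smul]

include hφ he in
theorem eq_smul_posVec {α : H.root} (hα : b.IsPos α) {a : L} (ha : φ a ∈ rootSpace H α.1) :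
    a = posCoord φ α a • e α := by
  apply hφ
  rw [map_smul, he α hα, posCoord_apply, ← eq_smul_rootVec ha]

theorem isPos_ne_neg {α β : H.root} (hα : b.IsPos α) (hβ : b.IsPos β) :
    (rootSystem H).root α ≠ - (rootSystem H).root β := by
  intro h
  obtain ⟨k, hk, hkp⟩ := exists_root_eq_neg b β
  obtain rfl : α = k := (rootSystem H).root.injective (h.trans hk.symm)
  exact hkp.mp hα hβ

include hφ he in
theorem lie_posVec_eq_zero {α β : H.root} (hα : b.IsPos α) (hβ : b.IsPos β)
    (h : (rootSystem H).root α + (rootSystem H).root β ∉ Set.range (rootSystem H).root) :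
    ⁅e α, e β⁆ = 0 := by
  apply hφ
  rw [LieHom.map_lie, he α hα, he β hβ, map_zero]
  exact lie_eq_zero_of_add_notMem (isPos_ne_neg hα hβ) h (rootVec_mem α) (rootVec_mem β)

include hφ he in
theorem exists_lie_posVec_eq_smul {α β γ : H.root} (hα : b.IsPos α) (hβ : b.IsPos β)
    (h : (rootSystem H).root γ = (rootSystem H).root α + (rootSystem H).root β) :
    ∃ c : ℝ, c ≠ 0 ∧ ⁅e α, e β⁆ = c • e γ := by
  have hγ := hα.add hβ h
  have h1 : φ ⁅e α, e β⁆ = ⁅rootVec α, rootVec β⁆ := by rw [LieHom.map_lie, he α hα, he β hβ]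
  have h2 : φ ⁅e α, e β⁆ ∈ rootSpace H γ.1 := by
    rw [h1]
    exact lie_mem_rootSpace_of_root_eq_add h (rootVec_mem α) (rootVec_mem β)
  refine ⟨_, fun h0 => ?_, eq_smul_posVec hφ he hγ h2⟩
  have h3 := eq_smul_posVec hφ he hγ h2
  rw [h0, zero_smul] at h3
  rw [h3, map_zero] at h1
  exact lie_ne_zero_of_root_eq_add h (rootVec_mem α) (rootVec_mem β) (rootVec_ne_zero α)
    (rootVec_ne_zero β) h1.symm

-- The algebra is not abelian: some θ = β + β' gives root vectors whose bracket is a nonzero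
-- multiple of e θ.
include hφ hr in
open Classical in
theorem exists_nilIndex_eq [(rootSystem H).IsIrreducible] [LieRing.IsNilpotent L]
    (h2 : 2 ≤ (Finset.univ.filter fun α => b.IsPos α).card) : ∃ k, nilIndex L = k + 2 := by
  obtain ⟨e, he⟩ := exists_posVec hr
  obtain ⟨β₀, -⟩ := Finset.card_pos.mp (lt_of_lt_of_le two_pos h2)
  have : Nonempty H.root := ⟨β₀⟩
  obtain ⟨θ, hθ⟩ := exists_isTopRoot b
  obtain ⟨β, hβ⟩ := hθ.exists_pairingIn_eq_one h2
  obtain ⟨β', hβ', hβ'1⟩ := hθ.exists_complement hβ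
  obtain ⟨c, hc, hlie⟩ := exists_lie_posVec_eq_smul hφ he (hθ.isPos_of_pairingIn_eq_one hβ)
    (hθ.isPos_of_pairingIn_eq_one hβ'1) (γ := θ) (by rw [hβ']; abel)
  have hne : e θ ≠ 0 := fun h => rootVec_ne_zero θ (by rw [← he θ hθ.1, h, map_zero])
  by_contra! hcon
  have hle : LieModule.nilpotencyLength L L ≤ 1 := by
    by_contra! h
    exact hcon (LieModule.nilpotencyLength L L - 2) (show LieModule.nilpotencyLength L L = _ by omega)
  have := LieModule.isTrivial_of_nilpotencyLength_le_one L L hle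
  rw [LieModule.IsTrivial.trivial] at hlie
  exact smul_ne_zero hc hne hlie.symm

include hφ hr in
/-- If a closed two-form does not vanish on `z ∈ L` central, then it does not vanish on a central
root vector and some other root vector. -/
theorem exists_top_of_closed {ω : Cochain L 2} {z y : L} (hz : ∀ x : L, ⁅z, x⁆ = 0)
    (hzy : ω ![z, y] ≠ 0) : ∃ θ, IsTopRoot b θ ∧ ∃ w : L, φ w ∈ rootSpace H θ.1 ∧
      (∀ x : L, ⁅w, x⁆ = 0) ∧ ω ![w, y] ≠ 0 := by
  -- The center of the positive part is stable under H by the Jacobi identity, so it is the sum of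
  -- its weight parts. One of them is not contained in W, the image of the elements ω-orthogonal to
  -- y.
  let Z : LieSubmodule ℝ H g₀ :=
    { carrier := {x | x ∈ nPlus b ∧ ∀ y ∈ nPlus b, ⁅x, y⁆ = 0}
      add_mem' := fun {x x'} hx hx' =>
        ⟨add_mem hx.1 hx'.1, fun y hy => by rw [add_lie, hx.2 y hy, hx'.2 y hy, add_zero]⟩
      zero_mem' := ⟨zero_mem _, fun y _ => zero_lie y⟩
      smul_mem' := fun c x hx =>
        ⟨Submodule.smul_mem _ _ hx.1, fun y hy => by rw [smul_lie, hx.2 y hy, smul_zero]⟩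
      lie_mem := fun {h x} hx => by
        refine ⟨cartan_lie_mem_nPlus h.2 hx.1, fun y hy => ?_⟩
        change ⁅⁅(h : g₀), x⁆, y⁆ = 0
        rw [lie_lie, hx.2 y hy, hx.2 _ (cartan_lie_mem_nPlus h.2 hy), lie_zero, sub_zero] }
  let W : Submodule ℝ g₀ :=
    (LinearMap.ker ((toBilin ω).flip y)).map (φ : L →ₗ[ℝ] g₀)
  have hzZ : φ z ∈ Z := by
    refine ⟨(hr _).mpr ⟨z, rfl⟩, fun y hy => ?_⟩
    obtain ⟨x, rfl⟩ := (hr _).mp hy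
    rw [← LieHom.map_lie, hz, map_zero]
  have hnot : ¬ (Z : Submodule ℝ g₀) ≤ W := by
    intro h
    obtain ⟨w, hw, hwz⟩ := h hzZ
    have : w = z := hφ hwz
    subst this
    exact hzy hw
  have hZdec : Z = ⨆ χ : Weight ℝ H g₀, Z ⊓ genWeightSpace g₀ χ :=
    eq_iSup_inf_genWeightSpace ℝ H g₀ Z
  rw [hZdec, LieSubmodule.iSup_toSubmodule, iSup_le_iff] at hnot
  push Not at hnot
  obtain ⟨χ, hχ⟩ := hnot
  obtain ⟨x, hx, hxW⟩ := SetLike.not_le_iff_exists.mp hχ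
  obtain ⟨hxZ, hxχ⟩ : x ∈ Z ∧ x ∈ genWeightSpace g₀ χ := (LieSubmodule.mem_inf _ _ _).mp hx
  obtain ⟨hxn, hxc⟩ : x ∈ nPlus b ∧ ∀ y ∈ nPlus b, ⁅x, y⁆ = 0 := hxZ
  have hx0 : x ≠ 0 := fun h => hxW (h ▸ zero_mem _)
  have hχ0 : χ.IsNonZero := by
    intro hχ
    apply hx0
    rw [eq_sum_of_mem_nPlus hxn]
    refine Finset.sum_eq_zero fun α _ => ?_
    rw [rootCoord_eq_zero (χ := χ) ?_ hxχ, zero_smul]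
    rw [show (χ : H → ℝ) = 0 from hχ]
    exact coe_root_ne_zero α
  let θ : H.root := ⟨χ, by simpa using hχ0⟩
  have hxθ : x ∈ rootSpace H θ.1 := hxχ
  have hθ : b.IsPos θ := by
    by_contra hn
    apply hx0
    rw [eq_smul_rootVec hxθ, rootCoord_eq_zero_of_mem_nPlus hn hxn, zero_smul]
  obtain ⟨w, rfl⟩ := (hr x).mp hxn
  refine ⟨θ, ⟨hθ, ?_⟩, w, hxθ, fun y => hφ ?_, fun h0 => hxW ⟨w, h0, rfl⟩⟩
  · rintro β hβ ⟨γ, hγ⟩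
    exact lie_ne_zero_of_root_eq_add hγ hxθ (rootVec_mem β) hx0 (rootVec_ne_zero β)
      (hxc _ (rootVec_mem_nPlus hβ))
  · rw [LieHom.map_lie, hxc _ ((hr _).mpr ⟨y, rfl⟩), map_zero]

-- The root vectors of the roots pairing to 1 with θ^∨ span a Heisenberg subspace V with center the
-- line of w. The root γ with ω(w, e γ) ≠ 0 decides which of the two bounds on dim V applies.
include hφ hr in
open Classical in
theorem exists_top_card_le_two {ω : Cochain L 2} (hω : ceDiff L 2 ω = 0) {z y : L}
    (hz : ∀ x : L, ⁅z, x⁆ = 0) (hzy : ω ![z, y] ≠ 0) : ∃ θ, IsTopRoot b θ ∧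
      (Finset.univ.filter fun γ => (rootSystem H).pairingIn ℤ γ θ = 1).card ≤ 2 := by
  have : FiniteDimensional ℝ L := FiniteDimensional.of_injective (φ : L →ₗ[ℝ] g₀) hφ
  obtain ⟨θ, hθ, w, hwθ, hw, hwy⟩ := exists_top_of_closed hφ hr hz hzy
  refine ⟨θ, hθ, ?_⟩
  obtain ⟨e, he⟩ := exists_posVec hr
  have hweq := eq_smul_posVec hφ he hθ.1 hwθ
  set c := posCoord φ θ w
  have hc : c ≠ 0 := by
    intro h
    rw [h, zero_smul] at hweq
    rw [hweq, ← toBilin_apply, map_zero] at hwy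
    exact hwy rfl
  obtain ⟨γ, hγ, hwγ⟩ : ∃ γ, b.IsPos γ ∧ ω ![w, e γ] ≠ 0 := by
    by_contra! hcon
    apply hwy
    rw [← toBilin_apply, eq_sum_posCoord hφ hr he y, map_sum]
    refine Finset.sum_eq_zero fun γ hγ => ?_
    rw [map_smul, toBilin_apply, hcon γ (Finset.mem_filter.mp hγ).2, smul_zero]
  let S := {γ : H.root // (rootSystem H).pairingIn ℤ γ θ = 1}
  have hpos : ∀ β : S, b.IsPos β.1 := fun β => hθ.isPos_of_pairingIn_eq_one β.2
  have hli : LinearIndependent ℝ fun β : S => e β.1 := by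
    rw [Fintype.linearIndependent_iff]
    intro a ha β
    have := congrArg (posCoord φ β.1) ha
    rw [map_sum, map_zero, Finset.sum_eq_single β] at this
    · rwa [map_smul, posCoord_posVec_self he (hpos β), smul_eq_mul, mul_one] at this
    · intro δ _ hδ
      rw [map_smul, posCoord_posVec_of_ne he (hpos δ) (fun h => hδ (Subtype.ext h)), smul_zero]
    · simp
  set V := Submodule.span ℝ (Set.range fun β : S => e β.1)
  have hVfr : Module.finrank ℝ V =
      (Finset.univ.filter fun γ => (rootSystem H).pairingIn ℤ γ θ = 1).card := by
    rw [finrank_span_eq_card hli, Fintype.card_subtype]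
  rw [← hVfr]
  have hgen : ∀ β δ : S, ∃ r : ℝ, ⁅e β.1, e δ.1⁆ = r • w := by
    intro β δ
    by_cases h : (rootSystem H).root β.1 + (rootSystem H).root δ.1 ∈ Set.range (rootSystem H).root
    · obtain ⟨k, hk⟩ := h
      obtain rfl := hθ.eq_of_add_eq β.2 δ.2 hk
      obtain ⟨r, -, hr⟩ := exists_lie_posVec_eq_smul hφ he (hpos β) (hpos δ) hk
      refine ⟨r * c⁻¹, ?_⟩
      rw [hr, hweq, smul_smul, mul_assoc, inv_mul_cancel₀ hc, mul_one]
    · exact ⟨0, by rw [lie_posVec_eq_zero hφ he (hpos β) (hpos δ) h, zero_smul]⟩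
  have hV : ∀ u ∈ V, ∀ v ∈ V, ∃ r : ℝ, ⁅u, v⁆ = r • w := by
    intro u hu v hv
    induction hu using Submodule.span_induction with
    | mem u hu =>
      obtain ⟨β, rfl⟩ := hu
      induction hv using Submodule.span_induction with
      | mem v hv => obtain ⟨δ, rfl⟩ := hv; exact hgen β δ
      | zero => exact ⟨0, by simp⟩
      | add v v' _ _ h h' =>
        obtain ⟨r, hr⟩ := h; obtain ⟨r', hr'⟩ := h'
        exact ⟨r + r', by rw [lie_add, hr, hr', add_smul]⟩
      | smul a v _ h => obtain ⟨r, hr⟩ := h; exact ⟨a * r, by rw [lie_smul, hr, mul_smul]⟩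
    | zero => exact ⟨0, by simp⟩
    | add v v' _ _ h h' =>
      obtain ⟨r, hr⟩ := h; obtain ⟨r', hr'⟩ := h'
      exact ⟨r + r', by rw [add_lie, hr, hr', add_smul]⟩
    | smul a v _ h => obtain ⟨r, hr⟩ := h; exact ⟨a * r, by rw [smul_lie, hr, mul_smul]⟩
  -- Bracketing with the vector of θ - β isolates the coefficient of β, since only β adds to θ - β
  -- to give θ.
  have hn : ∀ u ∈ V, (∀ v ∈ V, ⁅u, v⁆ = 0) → u = 0 := by
    intro u hu h
    obtain ⟨a, rfl⟩ := (Submodule.mem_span_range_iff_exists_fun ℝ).mp hu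
    refine Finset.sum_eq_zero fun β _ => ?_
    obtain ⟨β', hβ', hβ'1⟩ := hθ.exists_complement β.2
    have h1 := h (e β') (Submodule.subset_span ⟨⟨β', hβ'1⟩, rfl⟩)
    rw [sum_lie, Finset.sum_eq_single β] at h1
    · obtain ⟨r, hr, hlie⟩ := exists_lie_posVec_eq_smul hφ he (hpos β)
        (hθ.isPos_of_pairingIn_eq_one hβ'1) (γ := θ) (by rw [hβ']; abel)
      rw [smul_lie, hlie, smul_smul] at h1
      have he0 : e θ ≠ 0 := fun h => rootVec_ne_zero θ (by rw [← he θ hθ.1, h, map_zero])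
      have h2 : a β = 0 := by
        rcases mul_eq_zero.mp ((smul_eq_zero.mp h1).resolve_right he0) with h | h
        · exact h
        · exact absurd h hr
      rw [h2, zero_smul]
    · intro δ _ hδ
      rw [smul_lie, lie_posVec_eq_zero hφ he (hpos δ) (hθ.isPos_of_pairingIn_eq_one hβ'1), smul_zero]
      rintro ⟨k, hk⟩
      obtain rfl := hθ.eq_of_add_eq δ.2 hβ'1 hk
      apply hδ
      apply Subtype.ext
      apply (rootSystem H).root.injective
      rw [hβ'] at hk
      rw [← sub_eq_zero]
      have : (rootSystem H).root δ.1 - (rootSystem H).root β.1 =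
        ((rootSystem H).root δ.1 + ((rootSystem H).root k - (rootSystem H).root β.1)) -
          (rootSystem H).root k := by abel
      rw [this, ← hk, sub_self]
    · simp
  rcases hθ.pairingIn_of_isPos hγ with h | h | h
  · exfalso
    subst h
    apply hwγ
    rw [hweq, ← toBilin_apply, map_smul, LinearMap.smul_apply, toBilin_self, smul_zero]
  · exact finrank_le_two_of_heisenberg hω hwγ hV hn (Submodule.subset_span ⟨⟨γ, h⟩, rfl⟩)
  -- When γ is orthogonal to θ, adding γ does not change the pairing with θ^∨, so ad e γ preserves
  -- V.
  · have : V = ⊥ := by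
      refine eq_bot_of_heisenberg hω hw hwγ hV hn fun v hv => ?_
      induction hv using Submodule.span_induction with
      | mem v hv =>
        obtain ⟨β, rfl⟩ := hv
        by_cases hk : (rootSystem H).root γ + (rootSystem H).root β.1 ∈
            Set.range (rootSystem H).root
        · obtain ⟨k, hk⟩ := hk
          obtain ⟨r, -, hr⟩ := exists_lie_posVec_eq_smul hφ he hγ (hpos β) hk
          rw [hr]
          refine Submodule.smul_mem _ _ (Submodule.subset_span ⟨⟨k, ?_⟩, rfl⟩)
          rw [pairingIn_add hk, h, β.2, zero_add]
        · rw [lie_posVec_eq_zero hφ he hγ (hpos β) hk]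
          exact zero_mem _
      | zero => simp
      | add v v' _ _ h h' => rw [lie_add]; exact add_mem h h'
      | smul a v _ h => rw [lie_smul]; exact Submodule.smul_mem _ _ h
    rw [this, finrank_bot]
    omega

end PositiveNilpotent

/-! ### Symplectic forms when θ splits in a unique way -/

section PositiveNilpotent

open LieAlgebra LieAlgebra.IsKilling LieModule

variable {g₀ : Type*} [LieRing g₀] [LieAlgebra ℝ g₀] [FiniteDimensional ℝ g₀]
  [IsSemisimple ℝ g₀] {H : LieSubalgebra ℝ g₀} [H.IsCartanSubalgebra]
  [LieModule.IsTriangularizable ℝ H g₀] {b : (rootSystem H).Base}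
  {L : Type*} [LieRing L] [LieAlgebra ℝ L] {φ : L →ₗ⁅ℝ⁆ g₀}
  (hφ : Function.Injective φ) (hr : ∀ x, x ∈ nPlus b ↔ ∃ y, φ y = x)

theorem HasUniqueSplitting.ne {θ β β' : H.root}
    (h : HasUniqueSplitting (P := rootSystem H) θ β β') : β ≠ β' := by
  rintro rfl
  have h3 := LinearIndependent.pair_iff.mp (linearIndependent_of_pairingIn_eq_one h.1) (-1) 2
    (by rw [neg_smul, one_smul, two_smul]; nth_rewrite 1 [h.2.1]; abel)
  exact two_ne_zero h3.2

theorem HasUniqueSplitting.pairingIn_right {θ β β' : H.root}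
    (h : HasUniqueSplitting (P := rootSystem H) θ β β') :
    (rootSystem H).pairingIn ℤ β' θ = 1 := by
  rw [pairingIn_sub h.2.1, (rootSystem H).pairingIn_same, h.1]; norm_num

theorem HasUniqueSplitting.symm {θ β β' : H.root}
    (h : HasUniqueSplitting (P := rootSystem H) θ β β') :
    HasUniqueSplitting (P := rootSystem H) θ β' β :=
  ⟨h.pairingIn_right, by rw [h.2.1]; abel, fun γ hγ => (h.2.2 γ hγ).symm⟩

include hφ in
theorem lie_posVec_top_eq_zero {e : H.root → L} (he : ∀ α, b.IsPos α → φ (e α) = rootVec α)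
    {θ α : H.root} (hθ : IsTopRoot b θ) (hα : b.IsPos α) : ⁅e α, e θ⁆ = 0 :=
  lie_posVec_eq_zero hφ he hα hθ.1 (by rw [add_comm]; exact hθ.2 α hα)

theorem finrank_trivExt [FiniteDimensional ℝ L] (s : ℕ) :
    Module.finrank ℝ (TrivExt L s) = s + Module.finrank ℝ L := by
  rw [Module.finrank_prod, finrank_abelianLie]

include hφ hr in
open Classical in
theorem isSymplectic_trivExt_of_chain {θ β β' δ : H.root} (hθ : IsTopRoot b θ)
    (h : HasUniqueSplitting (P := rootSystem H) θ β β') (hδ : b.IsPos δ)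
    (hδθ : (rootSystem H).pairingIn ℤ δ θ = 0)
    (hadd : (rootSystem H).root β' = (rootSystem H).root β + (rootSystem H).root δ)
    (hpos : (Finset.univ.filter fun α => b.IsPos α) = {θ, β, β', δ}) {s : ℕ} (hs : Even s) :
    IsSymplectic (TrivExt L s) := by
  obtain ⟨e, he⟩ := exists_posVec hr
  have hβ := hθ.isPos_of_pairingIn_eq_one h.1
  have hβ' := hθ.isPos_of_pairingIn_eq_one h.pairingIn_right
  have h1 : β ≠ β' := h.ne
  have h2 : β ≠ θ := IsTopRoot.ne_of_pairingIn_eq_one h.1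
  have h3 : β' ≠ θ := IsTopRoot.ne_of_pairingIn_eq_one h.pairingIn_right
  have h4 : δ ≠ θ := by rintro rfl; rw [RootPairing.pairingIn_same] at hδθ; norm_num at hδθ
  have h5 : δ ≠ β := by rintro rfl; rw [h.1] at hδθ; norm_num at hδθ
  have h6 : δ ≠ β' := by rintro rfl; rw [h.pairingIn_right] at hδθ; norm_num at hδθ
  have hδ0 := (rootSystem H).ne_zero δ
  obtain ⟨c₁, hc₁, hl₁⟩ := exists_lie_posVec_eq_smul hφ he hβ hδ hadd
  obtain ⟨c₂, hc₂, hl₂⟩ := exists_lie_posVec_eq_smul hφ he hβ hβ' (γ := θ) (by rw [h.2.1]; abel)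
  -- A root β' + δ would pair to 1 with θ^∨, hence be β or β'; since β' = β + δ, either case gives δ
  -- = 0.
  have hl₃ : ⁅e δ, e β'⁆ = 0 := by
    refine lie_posVec_eq_zero hφ he hδ hβ' ?_
    rintro ⟨k, hk⟩
    have hkθ := pairingIn_add hk θ
    rw [hδθ, h.pairingIn_right, zero_add] at hkθ
    rcases h.2.2 k hkθ with rfl | rfl
    · rw [hadd, ← sub_eq_zero] at hk
      have : (2 : ℝ) • (rootSystem H).root δ = 0 := by
        rw [two_smul, ← neg_eq_zero, ← hk]; abel
      exact hδ0 ((smul_eq_zero.mp this).resolve_left two_ne_zero)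
    · exact hδ0 (right_eq_add.mp hk)
  -- Rescaling e β' by c₁ and e θ by c₁c₂ turns the structure constants into 1; the dual coordinates
  -- are rescaled inversely.
  refine isSymplectic_trivExt_of_filiform_basis (X := posCoord φ β) (Y := posCoord φ δ)
    (U := c₁⁻¹ • posCoord φ β') (V := (c₁ * c₂)⁻¹ • posCoord φ θ)
    (x := e β) (y := e δ) (u := c₁ • e β') (v := (c₁ * c₂) • e θ) (fun a => ?_) hl₁
    (by rw [lie_smul, hl₂, smul_smul])
    (by rw [lie_smul, lie_posVec_top_eq_zero hφ he hθ hβ, smul_zero])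
    (by rw [lie_smul, hl₃, smul_zero])
    (by rw [lie_smul, lie_posVec_top_eq_zero hφ he hθ hδ, smul_zero])
    (by rw [lie_smul, smul_lie, lie_posVec_top_eq_zero hφ he hθ hβ', smul_zero, smul_zero])
    ?_ ?_ ?_ ?_ hs
  · conv_lhs => rw [eq_sum_posCoord hφ hr he a, hpos]
    rw [Finset.sum_insert (by simp [h2.symm, h3.symm, h4.symm]),
      Finset.sum_insert (by simp [h1, h5.symm]), Finset.sum_insert (by simp [h6.symm]),
      Finset.sum_singleton]
    simp only [LinearMap.smul_apply, smul_smul, smul_eq_mul]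
    rw [mul_right_comm, inv_mul_cancel₀ hc₁, mul_right_comm,
      inv_mul_cancel₀ (mul_ne_zero hc₁ hc₂), one_mul, one_mul]
    abel
  all_goals
    simp only [LinearMap.smul_apply, map_smul, smul_eq_mul, posCoord_posVec_self he hβ,
      posCoord_posVec_self he hβ', posCoord_posVec_self he hδ, posCoord_posVec_self he hθ.1,
      posCoord_posVec_of_ne he hβ h1, posCoord_posVec_of_ne he hβ h2,
      posCoord_posVec_of_ne he hβ h5.symm, posCoord_posVec_of_ne he hβ' h1.symm,
      posCoord_posVec_of_ne he hβ' h3, posCoord_posVec_of_ne he hβ' h6.symm,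
      posCoord_posVec_of_ne he hδ h4, posCoord_posVec_of_ne he hδ h5,
      posCoord_posVec_of_ne he hδ h6, posCoord_posVec_of_ne he hθ.1 h2.symm,
      posCoord_posVec_of_ne he hθ.1 h3.symm, posCoord_posVec_of_ne he hθ.1 h4.symm, mul_zero,
      mul_one, true_and, and_true]
  · exact mul_inv_cancel₀ hc₁
  · exact mul_inv_cancel₀ (mul_ne_zero hc₁ hc₂)

include hφ hr in
open Classical in
theorem isSymplectic_trivExt_of_triple {θ β β' : H.root} (hθ : IsTopRoot b θ)
    (h : HasUniqueSplitting (P := rootSystem H) θ β β')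
    (hpos : (Finset.univ.filter fun α => b.IsPos α) = {θ, β, β'}) {s : ℕ} (hs : Odd s) :
    IsSymplectic (TrivExt L s) := by
  obtain ⟨e, he⟩ := exists_posVec hr
  have hβ := hθ.isPos_of_pairingIn_eq_one h.1
  have hβ' := hθ.isPos_of_pairingIn_eq_one h.pairingIn_right
  have h1 : β ≠ β' := h.ne
  have h2 : β ≠ θ := IsTopRoot.ne_of_pairingIn_eq_one h.1
  have h3 : β' ≠ θ := IsTopRoot.ne_of_pairingIn_eq_one h.pairingIn_right
  obtain ⟨c, hc, hl⟩ := exists_lie_posVec_eq_smul hφ he hβ hβ' (γ := θ) (by rw [h.2.1]; abel)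
  refine isSymplectic_trivExt_of_heisenberg_basis (X := posCoord φ β) (Y := posCoord φ β')
    (Z := c⁻¹ • posCoord φ θ) (x := e β) (y := e β') (z := c • e θ) (fun a => ?_) hl
    (by rw [lie_smul, lie_posVec_top_eq_zero hφ he hθ hβ, smul_zero])
    (by rw [lie_smul, lie_posVec_top_eq_zero hφ he hθ hβ', smul_zero]) ?_ ?_ ?_ hs
  · conv_lhs => rw [eq_sum_posCoord hφ hr he a, hpos]
    rw [Finset.sum_insert (by simp [h2.symm, h3.symm]), Finset.sum_insert (by simp [h1]),
      Finset.sum_singleton]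
    simp only [LinearMap.smul_apply, smul_smul, smul_eq_mul]
    rw [mul_right_comm, inv_mul_cancel₀ hc, one_mul]
    abel
  all_goals
    simp only [LinearMap.smul_apply, map_smul, smul_eq_mul, posCoord_posVec_self he hβ,
      posCoord_posVec_self he hβ', posCoord_posVec_self he hθ.1,
      posCoord_posVec_of_ne he hβ h1, posCoord_posVec_of_ne he hβ h2,
      posCoord_posVec_of_ne he hβ' h1.symm, posCoord_posVec_of_ne he hβ' h3,
      posCoord_posVec_of_ne he hθ.1 h2.symm, posCoord_posVec_of_ne he hθ.1 h3.symm, mul_zero,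
      mul_one, true_and]
  exact mul_inv_cancel₀ hc

include hφ hr in
theorem isSymplectic_trivExt_of_hasUniqueSplitting [(rootSystem H).IsIrreducible]
    {θ β β' : H.root} (hθ : IsTopRoot b θ)
    (h : HasUniqueSplitting (P := rootSystem H) θ β β') {s : ℕ}
    (hs : Even (Module.finrank ℝ (TrivExt L s))) : IsSymplectic (TrivExt L s) := by
  classical
  have : FiniteDimensional ℝ L := FiniteDimensional.of_injective (φ : L →ₗ[ℝ] g₀) hφ
  have h1 : β ≠ β' := h.ne
  have h2 : β ≠ θ := IsTopRoot.ne_of_pairingIn_eq_one h.1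
  have h3 : β' ≠ θ := IsTopRoot.ne_of_pairingIn_eq_one h.pairingIn_right
  have hβ := hθ.isPos_of_pairingIn_eq_one h.1
  have hβ' := hθ.isPos_of_pairingIn_eq_one h.pairingIn_right
  rw [finrank_trivExt, finrank_eq_card_isPos hφ hr] at hs
  by_cases hex : ∃ δ, b.IsPos δ ∧ (rootSystem H).pairingIn ℤ δ θ = 0
  · obtain ⟨δ, hδ, hδθ⟩ := hex
    have h4 : δ ≠ θ := by rintro rfl; rw [RootPairing.pairingIn_same] at hδθ; norm_num at hδθ
    have h5 : δ ≠ β := by rintro rfl; rw [h.1] at hδθ; norm_num at hδθ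
    have h6 : δ ≠ β' := by rintro rfl; rw [h.pairingIn_right] at hδθ; norm_num at hδθ
    have hpos : (Finset.univ.filter fun α => b.IsPos α) = {θ, β, β', δ} := by
      ext α
      simp only [Finset.mem_filter, Finset.mem_univ, true_and, Finset.mem_insert,
        Finset.mem_singleton]
      constructor
      · intro hα
        rcases hθ.pairingIn_of_isPos hα with h' | h' | h'
        · exact Or.inl h'
        · rcases h.2.2 α h' with h' | h'
          · exact Or.inr (Or.inl h')
          · exact Or.inr (Or.inr (Or.inl h'))
        · exact Or.inr (Or.inr (Or.inr
            (hθ.orthogonal_unique h.1 h.2.1 h.2.2 hα hδ h' hδθ)))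
      · rintro (rfl | rfl | rfl | rfl)
        exacts [hθ.1, hβ, hβ', hδ]
    have hs' : Even s := by
      rw [hpos, Finset.card_insert_of_notMem (by simp [h2.symm, h3.symm, h4.symm]),
        Finset.card_insert_of_notMem (by simp [h1, h5.symm]), Finset.card_pair h6.symm] at hs
      exact (Nat.even_add.mp hs).mpr (by decide)
    rcases (hθ.eq_add_or_eq_sub h.1 h.2.1 h.2.2 hδθ).2 with h' | h'
    · exact isSymplectic_trivExt_of_chain hφ hr hθ h hδ hδθ h' hpos hs'
    -- If β' = β - δ, exchanging β and β' gives the other case.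
    · refine isSymplectic_trivExt_of_chain hφ hr hθ h.symm hδ hδθ (by rw [h']; abel) ?_ hs'
      rw [hpos, Finset.insert_comm β]
  · push Not at hex
    have hpos : (Finset.univ.filter fun α => b.IsPos α) = {θ, β, β'} := by
      ext α
      simp only [Finset.mem_filter, Finset.mem_univ, true_and, Finset.mem_insert,
        Finset.mem_singleton]
      constructor
      · intro hα
        rcases hθ.pairingIn_of_isPos hα with h' | h' | h'
        · exact Or.inl h'
        · exact Or.inr (h.2.2 α h')
        · exact absurd h' (hex α hα)
      · rintro (rfl | rfl | rfl)
        exacts [hθ.1, hβ, hβ']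
    refine isSymplectic_trivExt_of_triple hφ hr hθ h hpos ?_
    rw [hpos, Finset.card_insert_of_notMem (by simp [h2.symm, h3.symm]),
      Finset.card_pair h1] at hs
    by_contra hodd
    rw [Nat.not_odd_iff_even] at hodd
    exact absurd ((Nat.even_add.mp hs).mp hodd) (by decide)

end PositiveNilpotent

/-! ### Dimensions of the classical Lie algebras -/

section Dimensions

open LieAlgebra Matrix

attribute [local instance 100] LieRing.ofAssociativeRing

variable (K n : Type*) [Field K]

/-- The symmetric matrices. -/
def symMatrix : Submodule K (Matrix n n K) where
  carrier := {A | Aᵀ = A}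
  add_mem' {A B} hA hB := by rw [Set.mem_ofPred_eq] at *; rw [transpose_add, hA, hB]
  zero_mem' := transpose_zero
  smul_mem' c A hA := by rw [Set.mem_ofPred_eq] at *; rw [transpose_smul, hA]

variable {K n} in
theorem mem_symMatrix {A : Matrix n n K} : A ∈ symMatrix K n ↔ Aᵀ = A := Iff.rfl

/-- A symmetric matrix is a function on unordered pairs. -/
def symMatrixEquiv : symMatrix K n ≃ₗ[K] (Sym2 n → K) where
  toFun A := Sym2.lift ⟨fun i j => A.1 i j, fun i j => congrFun (congrFun A.2 j) i⟩
  map_add' A B := by ext ⟨i, j⟩; rfl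
  map_smul' c A := by ext ⟨i, j⟩; rfl
  invFun f := ⟨Matrix.of fun i j => f s(i, j), by
    ext i j
    change f s(j, i) = f s(i, j)
    rw [Sym2.eq_swap]⟩
  left_inv A := rfl
  right_inv f := by ext ⟨i, j⟩; rfl

variable [Fintype n]

theorem finrank_symMatrix :
    Module.finrank K (symMatrix K n) = (Fintype.card n + 1).choose 2 := by
  rw [(symMatrixEquiv K n).finrank_eq, Module.finrank_fintype_fun_eq_card, Sym2.card]

variable [DecidableEq n]

theorem finrank_sl [Nonempty n] :
    Module.finrank K (SpecialLinear.sl n K) + 1 = Fintype.card n * Fintype.card n := by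
  have h := LinearMap.finrank_range_add_finrank_ker (Matrix.traceLinearMap n K K)
  have hs : LinearMap.range (Matrix.traceLinearMap n K K) = ⊤ := by
    rw [LinearMap.range_eq_top]
    intro c
    obtain ⟨i⟩ := ‹Nonempty n›
    exact ⟨Matrix.single i i c, by simp⟩
  rw [hs, finrank_top, Module.finrank_self, Module.finrank_matrix, Module.finrank_self,
    mul_one] at h
  rw [← h, add_comm]
  rfl

/-- Rank-nullity for A ↦ A + Aᵀ: the kernel is so, and the image is all symmetric matrices because 2
is invertible. -/
theorem finrank_so [CharZero K] :
    (Fintype.card n + 1).choose 2 + Module.finrank K (Orthogonal.so n K) =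
      Fintype.card n * Fintype.card n := by
  let f : Matrix n n K →ₗ[K] Matrix n n K :=
    LinearMap.id + (Matrix.transposeLinearEquiv n n K K).toLinearMap
  have h := LinearMap.finrank_range_add_finrank_ker f
  have hr : LinearMap.range f = symMatrix K n := by
    ext A
    rw [mem_symMatrix]
    constructor
    · rintro ⟨B, rfl⟩
      change (B + Bᵀ)ᵀ = B + Bᵀ
      rw [transpose_add, transpose_transpose, add_comm]
    · intro hA
      refine ⟨(2⁻¹ : K) • A, ?_⟩
      change (2⁻¹ : K) • A + ((2⁻¹ : K) • A)ᵀ = A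
      rw [transpose_smul, hA, ← add_smul]
      norm_num
  have hk : LinearMap.ker f = (Orthogonal.so n K).toSubmodule := by
    ext A
    rw [LinearMap.mem_ker, LieSubalgebra.mem_toSubmodule, Orthogonal.mem_so, eq_neg_iff_add_eq_zero,
      add_comm]
    rfl
  rw [hr, hk, finrank_symMatrix, Module.finrank_matrix, Module.finrank_self, mul_one] at h
  exact h

variable {K n} in
theorem mem_sp {A : Matrix (n ⊕ n) (n ⊕ n) K} :
    A ∈ Symplectic.sp n K ↔ Aᵀ * J n K = J n K * (-A) := by
  rw [Symplectic.sp, mem_skewAdjointMatricesLieSubalgebra, mem_skewAdjointMatricesSubmodule,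
    Matrix.IsSkewAdjoint, Matrix.IsAdjointPair]

/-- Multiplication by J identifies sp with the symmetric matrices of size 2n. -/
theorem finrank_sp : Module.finrank K (Symplectic.sp n K) =
    (2 * Fintype.card n + 1).choose 2 := by
  have hJT : (J n K)ᵀ = -(J n K) := J_transpose n K
  have hJJ : J n K * J n K = -1 := J_squared n K
  let f : Symplectic.sp n K →ₗ[K] symMatrix K (n ⊕ n) :=
    { toFun := fun A => ⟨J n K * A.1, by
        have h : A.1ᵀ * J n K = J n K * (-A.1) := mem_sp.mp A.2
        rw [mem_symMatrix, transpose_mul, hJT, Matrix.mul_neg, h, Matrix.mul_neg, neg_neg]⟩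
      map_add' := fun A B => Subtype.ext (Matrix.mul_add _ _ _)
      map_smul' := fun c A => Subtype.ext (Matrix.mul_smul _ _ _) }
  have hf : Function.Bijective f := by
    constructor
    · intro A B h
      have h1 : J n K * A.1 = J n K * B.1 := congrArg Subtype.val h
      have h2 := congrArg (fun M => J n K * M) h1
      simp only [← Matrix.mul_assoc, hJJ, Matrix.neg_mul, Matrix.one_mul, neg_inj] at h2
      exact Subtype.ext h2
    · intro S
      refine ⟨⟨-(J n K * S.1), ?_⟩, Subtype.ext ?_⟩
      · rw [mem_sp, neg_neg, transpose_neg, transpose_mul, hJT, S.2, Matrix.mul_neg, neg_neg,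
          Matrix.mul_assoc, hJJ, ← Matrix.mul_assoc, hJJ, Matrix.mul_neg, Matrix.neg_mul,
          Matrix.mul_one, Matrix.one_mul]
      · change J n K * (-(J n K * S.1)) = S.1
        rw [Matrix.mul_neg, ← Matrix.mul_assoc, hJJ, Matrix.neg_mul, neg_neg, Matrix.one_mul]
  rw [(LinearEquiv.ofBijective f hf).finrank_eq, finrank_symMatrix, Fintype.card_sum, two_mul]

end Dimensions

/-! ### The isomorphism of sp(4) with so(5) -/

section SpFour

open LieAlgebra Matrix

attribute [local instance 100] LieRing.ofAssociativeRing

variable (K : Type*) [Field K]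

/-- A split symmetric bilinear form in dimension five. -/
def splitForm : Matrix (Fin 5) (Fin 5) K :=
  !![2, 0, 0, 0, 0; 0, 0, 0, 1, 0; 0, 0, 0, 0, 1; 0, 1, 0, 0, 0; 0, 0, 1, 0, 0]

variable {K}

theorem sp_apply (A : Symplectic.sp (Fin 2) K) (i j : Fin 2) :
    A.1 (Sum.inl i) (Sum.inr j) = A.1 (Sum.inl j) (Sum.inr i) ∧
    A.1 (Sum.inr i) (Sum.inl j) = A.1 (Sum.inr j) (Sum.inl i) ∧
    A.1 (Sum.inr i) (Sum.inr j) = - A.1 (Sum.inl j) (Sum.inl i) := by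
  have h : A.1ᵀ * J (Fin 2) K = J (Fin 2) K * (-A.1) := mem_sp.mp A.2
  have h1 := congrFun (congrFun h (Sum.inr j)) (Sum.inr i)
  have h2 := congrFun (congrFun h (Sum.inl j)) (Sum.inl i)
  have h3 := congrFun (congrFun h (Sum.inl i)) (Sum.inr j)
  simp [Matrix.mul_apply, J, Fintype.sum_sum_type, Matrix.one_apply] at h1 h2 h3
  exact ⟨h1, h2, by simpa using h3.symm⟩

/-- The action of the block matrix with rows `(a, b)` and `(c, -aᵀ)` of `sp(4)` on the primitive
part of the second exterior power. -/
def spFourMat (a₁₁ a₁₂ a₂₁ a₂₂ p q r s t u : K) : Matrix (Fin 5) (Fin 5) K :=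
  !![0, t, -a₂₁, -q, a₁₂;
    2 * q, a₁₁ + a₂₂, r, 0, -p;
    -(2 * a₁₂), u, a₁₁ - a₂₂, p, 0;
    -(2 * t), 0, s, -(a₁₁ + a₂₂), -u;
    2 * a₂₁, -s, 0, -r, a₂₂ - a₁₁]

theorem spFourMat_transpose_mul (a₁₁ a₁₂ a₂₁ a₂₂ p q r s t u : K) :
    (spFourMat a₁₁ a₁₂ a₂₁ a₂₂ p q r s t u)ᵀ * splitForm K =
      splitForm K * (-spFourMat a₁₁ a₁₂ a₂₁ a₂₂ p q r s t u) := by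
  ext i j
  rw [Matrix.mul_apply, Matrix.mul_apply, Fin.sum_univ_five, Fin.sum_univ_five]
  simp only [Matrix.transpose_apply, Matrix.neg_apply]
  fin_cases i <;> fin_cases j <;>
    simp only [spFourMat, splitForm, Fin.mk_one, Fin.zero_eta, Fin.reduceFinMk, Matrix.of_apply,
      Matrix.cons_val] <;> ring

/-- The arguments on the right are the entries of the commutator of the block matrices, with b
symmetric of entries p, q, r and c symmetric of entries s, t, u. -/
theorem spFourMat_lie (a₁₁ a₁₂ a₂₁ a₂₂ p q r s t u a₁₁' a₁₂' a₂₁' a₂₂' p' q' r' s' t' u' : K) :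
    spFourMat a₁₁ a₁₂ a₂₁ a₂₂ p q r s t u * spFourMat a₁₁' a₁₂' a₂₁' a₂₂' p' q' r' s' t' u' -
      spFourMat a₁₁' a₁₂' a₂₁' a₂₂' p' q' r' s' t' u' * spFourMat a₁₁ a₁₂ a₂₁ a₂₂ p q r s t u =
    spFourMat (a₁₂ * a₂₁' + p * s' + q * t' - (a₁₂' * a₂₁ + p' * s + q' * t))
      (a₁₁ * a₁₂' + a₁₂ * a₂₂' + p * t' + q * u' - (a₁₁' * a₁₂ + a₁₂' * a₂₂ + p' * t + q' * u))
      (a₂₁ * a₁₁' + a₂₂ * a₂₁' + q * s' + r * t' - (a₂₁' * a₁₁ + a₂₂' * a₂₁ + q' * s + r' * t))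
      (a₂₁ * a₁₂' + q * t' + r * u' - (a₂₁' * a₁₂ + q' * t + r' * u))
      (2 * (a₁₁ * p' + a₁₂ * q') - 2 * (a₁₁' * p + a₁₂' * q))
      (a₁₁ * q' + a₁₂ * r' + a₂₁ * p' + a₂₂ * q' - (a₁₁' * q + a₁₂' * r + a₂₁' * p + a₂₂' * q))
      (2 * (a₂₁ * q' + a₂₂ * r') - 2 * (a₂₁' * q + a₂₂' * r))
      (2 * (s * a₁₁' + t * a₂₁') - 2 * (s' * a₁₁ + t' * a₂₁))
      (s * a₁₂' + t * a₂₂' + t * a₁₁' + u * a₂₁' - (s' * a₁₂ + t' * a₂₂ + t' * a₁₁ + u' * a₂₁))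
      (2 * (t * a₁₂' + u * a₂₂') - 2 * (t' * a₁₂ + u' * a₂₂)) := by
  ext i j
  rw [Matrix.sub_apply, Matrix.mul_apply, Matrix.mul_apply, Fin.sum_univ_five, Fin.sum_univ_five]
  fin_cases i <;> fin_cases j <;>
    simp only [spFourMat, Fin.mk_one, Fin.zero_eta, Fin.reduceFinMk, Matrix.of_apply,
      Matrix.cons_val] <;> ring

end SpFour

section SpFourSoFive

open LieAlgebra Matrix

attribute [local instance 100] LieRing.ofAssociativeRing

variable {K : Type*} [Field K]

theorem spFourMat_add (a₁₁ a₁₂ a₂₁ a₂₂ p q r s t u a₁₁' a₁₂' a₂₁' a₂₂' p' q' r' s' t' u' : K) :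
    spFourMat a₁₁ a₁₂ a₂₁ a₂₂ p q r s t u + spFourMat a₁₁' a₁₂' a₂₁' a₂₂' p' q' r' s' t' u' =
    spFourMat (a₁₁ + a₁₁') (a₁₂ + a₁₂') (a₂₁ + a₂₁') (a₂₂ + a₂₂') (p + p') (q + q') (r + r')
      (s + s') (t + t') (u + u') := by
  ext i j
  rw [Matrix.add_apply]
  fin_cases i <;> fin_cases j <;>
    simp only [spFourMat, Fin.mk_one, Fin.zero_eta, Fin.reduceFinMk, Matrix.of_apply,
      Matrix.cons_val] <;> ring

theorem smul_spFourMat (c a₁₁ a₁₂ a₂₁ a₂₂ p q r s t u : K) :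
    c • spFourMat a₁₁ a₁₂ a₂₁ a₂₂ p q r s t u =
    spFourMat (c * a₁₁) (c * a₁₂) (c * a₂₁) (c * a₂₂) (c * p) (c * q) (c * r) (c * s) (c * t)
      (c * u) := by
  ext i j
  rw [Matrix.smul_apply, smul_eq_mul]
  fin_cases i <;> fin_cases j <;>
    simp only [spFourMat, Fin.mk_one, Fin.zero_eta, Fin.reduceFinMk, Matrix.of_apply,
      Matrix.cons_val] <;> ring

variable (K) in
/-- The Lie algebra homomorphism from `sp(4)` to the split orthogonal Lie algebra in dimension
five. -/
def spFourHom : Symplectic.sp (Fin 2) K →ₗ⁅K⁆ skewAdjointMatricesLieSubalgebra (splitForm K) where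
  toFun A := ⟨spFourMat (A.1 (Sum.inl 0) (Sum.inl 0)) (A.1 (Sum.inl 0) (Sum.inl 1))
      (A.1 (Sum.inl 1) (Sum.inl 0)) (A.1 (Sum.inl 1) (Sum.inl 1))
      (A.1 (Sum.inl 0) (Sum.inr 0)) (A.1 (Sum.inl 0) (Sum.inr 1)) (A.1 (Sum.inl 1) (Sum.inr 1))
      (A.1 (Sum.inr 0) (Sum.inl 0)) (A.1 (Sum.inr 0) (Sum.inl 1)) (A.1 (Sum.inr 1) (Sum.inl 1)), by
    rw [mem_skewAdjointMatricesLieSubalgebra, mem_skewAdjointMatricesSubmodule,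
      Matrix.IsSkewAdjoint, Matrix.IsAdjointPair]
    exact spFourMat_transpose_mul _ _ _ _ _ _ _ _ _ _⟩
  map_add' A B := Subtype.ext (spFourMat_add _ _ _ _ _ _ _ _ _ _ _ _ _ _ _ _ _ _ _ _).symm
  map_smul' c A := Subtype.ext (smul_spFourMat c _ _ _ _ _ _ _ _ _ _).symm
  map_lie' {A B} := by
    apply Subtype.ext
    refine Eq.trans ?_ (spFourMat_lie _ _ _ _ _ _ _ _ _ _ _ _ _ _ _ _ _ _ _ _).symm
    have h : (⁅A, B⁆ : Symplectic.sp (Fin 2) K).1 = A.1 * B.1 - B.1 * A.1 := rfl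
    have hA1 := (sp_apply A 1 0).1
    have hA2 := (sp_apply A 1 0).2.1
    have hB1 := (sp_apply B 1 0).1
    have hB2 := (sp_apply B 1 0).2.1
    have hA3 := fun i j => (sp_apply A i j).2.2
    have hB3 := fun i j => (sp_apply B i j).2.2
    dsimp only
    congr 1 <;> simp only [h, Matrix.sub_apply, Matrix.mul_apply, Fintype.sum_sum_type,
      Fin.sum_univ_two, hA1, hA2, hA3, hB1, hB2, hB3] <;> ring

theorem spFourHom_injective [CharZero K] : Function.Injective (spFourHom K) := by
  rw [injective_iff_map_eq_zero]
  intro A hA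
  have h : ∀ i j, (spFourHom K A).1 i j = 0 := fun i j => by rw [hA]; rfl
  have h01 := h 0 1
  have h02 := h 0 2
  have h03 := h 0 3
  have h04 := h 0 4
  have h11 := h 1 1
  have h12 := h 1 2
  have h14 := h 1 4
  have h21 := h 2 1
  have h22 := h 2 2
  have h32 := h 3 2
  simp only [spFourHom, LieHom.coe_mk, spFourMat, Matrix.of_apply, Matrix.cons_val, neg_eq_zero]
    at h01 h02 h03 h04 h11 h12 h14 h21 h22 h32
  have h1 : A.1 (Sum.inl 0) (Sum.inl 0) = 0 := by linear_combination (h11 + h22) / 2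
  have h2 : A.1 (Sum.inl 1) (Sum.inl 1) = 0 := by linear_combination (h11 - h22) / 2
  have hs := sp_apply A
  have key : ∀ i j : Fin 2, A.1 (Sum.inl i) (Sum.inl j) = 0 ∧ A.1 (Sum.inl i) (Sum.inr j) = 0 ∧
      A.1 (Sum.inr i) (Sum.inl j) = 0 := by
    have hb := (hs 1 0).1
    have hc := (hs 1 0).2.1
    rw [h03] at hb
    rw [h01] at hc
    simp only [Fin.forall_fin_two]
    exact ⟨⟨⟨h1, h14, h32⟩, h04, h03, h01⟩, ⟨h02, hb, hc⟩, h2, h12, h21⟩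
  ext (i | i) (j | j)
  · exact (key i j).1
  · exact (key i j).2.1
  · exact (key i j).2.2
  · rw [(hs i j).2.2, (key j i).1]
    exact neg_zero

/-- A change of basis which makes the split form a multiple of the standard one. -/
def splitBasis : Matrix (Fin 5) (Fin 5) ℂ :=
  !![1, 0, 0, 0, 0; 0, 1, Complex.I, 0, 0; 0, 0, 0, 1, Complex.I; 0, 1, -Complex.I, 0, 0;
    0, 0, 0, 1, -Complex.I]

theorem splitBasis_transform : splitBasisᵀ * splitForm ℂ * splitBasis = (2 : ℂ) • 1 := by
  have h : splitBasisᵀ * splitForm ℂ = !![2, 0, 0, 0, 0; 0, 1, 0, 1, 0;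
      0, -Complex.I, 0, Complex.I, 0; 0, 0, 1, 0, 1; 0, 0, -Complex.I, 0, Complex.I] := by
    ext i j
    rw [Matrix.mul_apply, Fin.sum_univ_five]
    simp only [Matrix.transpose_apply]
    fin_cases i <;> fin_cases j <;>
      simp only [splitBasis, splitForm, Fin.mk_one, Fin.zero_eta, Fin.reduceFinMk, Matrix.of_apply,
        Matrix.cons_val] <;> ring
  rw [h]
  ext i j
  rw [Matrix.mul_apply, Fin.sum_univ_five, Matrix.smul_apply, Matrix.one_apply]
  fin_cases i <;> fin_cases j <;>
    simp [splitBasis] <;> norm_num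

/-- The two orthogonal Lie algebras in dimension five are isomorphic over `ℂ`. -/
def splitFormEquivSo :
    skewAdjointMatricesLieSubalgebra (splitForm ℂ) ≃ₗ⁅ℂ⁆ Orthogonal.so (Fin 5) ℂ :=
  (skewAdjointMatricesLieSubalgebraEquiv (splitForm ℂ) splitBasis
    (invertibleOfLeftInverse _ ((2 : ℂ)⁻¹ • (splitBasisᵀ * splitForm ℂ)) (by
      rw [Matrix.smul_mul, splitBasis_transform, smul_smul, inv_mul_cancel₀ two_ne_zero,
        one_smul]))).trans
  (LieEquiv.ofEq _ _ (by
    ext A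
    rw [splitBasis_transform]
    exact mem_skewAdjointMatricesLieSubalgebra_unit_smul (Units.mk0 (2 : ℂ) two_ne_zero) 1 A))

/-- Both sides have dimension 10, so the injective homomorphism to the split form of so(5) is
bijective. -/
theorem nonempty_spFour_equiv_soFive :
    Nonempty (Symplectic.sp (Fin 2) ℂ ≃ₗ⁅ℂ⁆ Orthogonal.so (Fin 5) ℂ) := by
  have h1 : Module.finrank ℂ (Symplectic.sp (Fin 2) ℂ) = 10 := by
    rw [finrank_sp, Fintype.card_fin]; rfl
  have h2 : Module.finrank ℂ (skewAdjointMatricesLieSubalgebra (splitForm ℂ)) = 10 := by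
    rw [splitFormEquivSo.toLinearEquiv.finrank_eq]
    have := finrank_so ℂ (Fin 5)
    rw [Fintype.card_fin, show Nat.choose (5 + 1) 2 = 15 from rfl] at this
    omega
  have hb : Function.Bijective (spFourHom ℂ) := by
    refine ⟨spFourHom_injective, ?_⟩
    exact (LinearMap.injective_iff_surjective_of_finrank_eq_finrank
      (f := (spFourHom ℂ : _ →ₗ[ℂ] _)) (h1.trans h2.symm)).mp spFourHom_injective
  exact ⟨(LieEquiv.ofBijective _ hb).trans splitFormEquivSo⟩

/-- The classical Lie algebras of dimension eight or ten. -/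
theorem IsClassical.sl_three_or_so_five {g : Type*} [LieRing g] [LieAlgebra ℂ g]
    (hg : IsClassical g) (h : Module.finrank ℂ g = 8 ∨ Module.finrank ℂ g = 10) :
    Nonempty (g ≃ₗ⁅ℂ⁆ SpecialLinear.sl (Fin 3) ℂ) ∨
      Nonempty (g ≃ₗ⁅ℂ⁆ Orthogonal.so (Fin 5) ℂ) := by
  -- The dimensions are m² - 1 (zero for m = 0), m(m - 1)/2 and m(2m + 1). The values 8 and 10 occur
  -- only for m = 3, m = 5 and m = 2 respectively.
  obtain ⟨m, ⟨⟨e⟩⟩ | ⟨⟨e⟩⟩ | ⟨⟨e⟩⟩⟩ := hg <;> rw [e.toLinearEquiv.finrank_eq] at h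
  · left
    obtain rfl : m = 3 := by
      rcases Nat.eq_zero_or_pos m with rfl | hm
      · have : Module.finrank ℂ (SpecialLinear.sl (Fin 0) ℂ) = 0 := Module.finrank_zero_of_subsingleton
        omega
      · have : Nonempty (Fin m) := ⟨⟨0, hm⟩⟩
        have hs := finrank_sl ℂ (Fin m)
        rw [Fintype.card_fin] at hs
        have hle : m * m ≤ 11 := by omega
        have : m ≤ 3 := by nlinarith
        interval_cases m <;> omega
    exact ⟨e⟩
  · right
    obtain rfl : m = 5 := by
      have hs := finrank_so ℂ (Fin m)
      rw [Fintype.card_fin, Nat.choose_two_right, Nat.add_sub_cancel] at hs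
      have h2 : 2 ∣ (m + 1) * m := (Nat.even_mul_pred_self (m + 1)).two_dvd
      have h3 := Nat.div_mul_cancel h2
      have h4 : (m + 1) * m = m * m + m := by ring
      have hle : m * m ≤ m + 20 := by omega
      have : m ≤ 5 := by nlinarith
      interval_cases m <;> omega
    exact ⟨e⟩
  · right
    obtain rfl : m = 2 := by
      rw [finrank_sp, Fintype.card_fin, Nat.choose_two_right, Nat.add_sub_cancel] at h
      have h2 : (2 * m + 1) * (2 * m) / 2 = (2 * m + 1) * m := by
        rw [mul_left_comm, Nat.mul_div_cancel_left _ two_pos]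
      rw [h2] at h
      have hle : (2 * m + 1) * m ≤ 10 := by omega
      have : m ≤ 2 := by nlinarith
      interval_cases m <;> omega
    obtain ⟨e'⟩ := nonempty_spFour_equiv_soFive
    exact ⟨e.trans e'⟩

theorem finrank_sl_three : Module.finrank ℂ (SpecialLinear.sl (Fin 3) ℂ) = 8 := by
  have := finrank_sl ℂ (Fin 3)
  rw [Fintype.card_fin] at this
  omega

theorem finrank_so_five : Module.finrank ℂ (Orthogonal.so (Fin 5) ℂ) = 10 := by
  have := finrank_so ℂ (Fin 5)
  rw [Fintype.card_fin, show Nat.choose (5 + 1) 2 = 15 from rfl] at this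
  omega

end SpFourSoFive

/-! ### Simplicity descends from the complexification -/

section BaseChange

open LieAlgebra

variable {g₀ : Type*} [LieRing g₀] [LieAlgebra ℝ g₀]

variable (g₀) in
/-- The real part of the complexification. -/
def realPart : ℂ ⊗[ℝ] g₀ →ₗ[ℝ] g₀ :=
  (TensorProduct.lid ℝ g₀).toLinearMap ∘ₗ Complex.reLm.rTensor g₀

theorem realPart_tmul (z : ℂ) (x : g₀) : realPart g₀ (z ⊗ₜ x) = z.re • x := by
  simp [realPart]

theorem realPart_mem {I : LieIdeal ℝ g₀} {t : ℂ ⊗[ℝ] g₀} (ht : t ∈ I.baseChange ℂ) :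
    realPart g₀ t ∈ I := by
  -- The base change is a complex span while the real part is only real linear, so the induction
  -- must carry all complex multiples.
  suffices h : ∀ z : ℂ, realPart g₀ (z • t) ∈ I by simpa using h 1
  rw [LieSubmodule.mem_baseChange_iff] at ht
  induction ht using Submodule.span_induction with
  | mem t ht =>
    obtain ⟨x, hx, rfl⟩ := ht
    intro z
    rw [TensorProduct.mk_apply, TensorProduct.smul_tmul', realPart_tmul]
    exact I.smul_mem _ hx
  | zero => intro z; rw [smul_zero, map_zero]; exact zero_mem _
  | add t t' _ _ h h' => intro z; rw [smul_add, map_add]; exact add_mem (h z) (h' z)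
  | smul a t _ h => intro z; rw [smul_smul]; exact h _

/-- An ideal I complexifies to an ideal that is zero or everything, and I is recovered from it by
looking at the elements 1 ⊗ x and taking real parts. -/
theorem isSimple_of_baseChange {g : Type*} [LieRing g] [LieAlgebra ℂ g] [IsSimple ℂ g]
    (e : ℂ ⊗[ℝ] g₀ ≃ₗ⁅ℂ⁆ g) : IsSimple ℝ g₀ where
  non_abelian := by
    intro hab
    refine IsSimple.non_abelian ℂ (L := g) ⟨fun x y => ?_⟩
    have key : ∀ s t : ℂ ⊗[ℝ] g₀, ⁅s, t⁆ = 0 := by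
      intro s t
      induction s using TensorProduct.induction_on with
      | zero => exact zero_lie t
      | add s s' h h' => rw [add_lie, h, h', add_zero]
      | tmul z a =>
        induction t using TensorProduct.induction_on with
        | zero => exact lie_zero (z ⊗ₜ[ℝ] a)
        | add t t' h h' => rw [lie_add (z ⊗ₜ[ℝ] a) t t', h, h', add_zero]
        | tmul w c =>
          rw [LieAlgebra.ExtendScalars.bracket_tmul, LieModule.IsTrivial.trivial,
            TensorProduct.tmul_zero]
    apply e.symm.injective
    rw [LieHom.map_lie, key, map_zero]
  eq_bot_or_eq_top := by
    intro I
    have hmem : ∀ t, e t ∈ LieIdeal.comap (e.symm : g →ₗ⁅ℂ⁆ ℂ ⊗[ℝ] g₀) (I.baseChange ℂ) ↔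
        t ∈ I.baseChange ℂ := by
      intro t
      rw [LieIdeal.mem_comap]
      change e.symm (e t) ∈ _ ↔ _
      rw [LieEquiv.symm_apply_apply]
    rcases IsSimple.eq_bot_or_eq_top (R := ℂ)
      (LieIdeal.comap (e.symm : g →ₗ⁅ℂ⁆ ℂ ⊗[ℝ] g₀) (I.baseChange ℂ)) with h | h
    · left
      rw [LieSubmodule.eq_bot_iff]
      intro x hx
      have h1 := (hmem (1 ⊗ₜ x)).mpr (LieSubmodule.tmul_mem_baseChange_of_mem 1 hx)
      rw [h, LieSubmodule.mem_bot] at h1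
      have h2 := e.injective (h1.trans (map_zero e).symm)
      have h3 := realPart_tmul (1 : ℂ) x
      rwa [h2, map_zero, Complex.one_re, one_smul, eq_comm] at h3
    · right
      rw [eq_top_iff]
      intro x _
      have h1 : (1 : ℂ) ⊗ₜ[ℝ] x ∈ I.baseChange ℂ := (hmem _).mp (h ▸ LieSubmodule.mem_top _)
      have h2 := realPart_mem h1
      rwa [realPart_tmul, Complex.one_re, one_smul] at h2

end BaseChange

end NilSymp

end

/-! ### The three equivalences -/

theorem corollary4p2
    {g : Type*} [LieRing g] [LieAlgebra ℂ g] [LieAlgebra.IsSimple ℂ g]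
    (hg : NilSymp.IsClassical g)
    {g₀ : Type*} [LieRing g₀] [LieAlgebra ℝ g₀] [FiniteDimensional ℝ g₀]
    [LieAlgebra.IsSemisimple ℝ g₀]
    (hg₀ : Nonempty (ℂ ⊗[ℝ] g₀ ≃ₗ⁅ℂ⁆ g))
    (H : LieSubalgebra ℝ g₀) [H.IsCartanSubalgebra] [LieModule.IsTriangularizable ℝ H g₀]
    (b : (LieAlgebra.IsKilling.rootSystem H).Base)
    (hdim : 2 ≤ Module.finrank ℝ (NilSymp.nilradical (NilSymp.minimalParabolic b))) :
    List.TFAE [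
      ∀ s : ℕ,
        Even (Module.finrank ℝ
          (NilSymp.TrivExt (NilSymp.nilradical (NilSymp.minimalParabolic b)) s)) →
        NilSymp.IsSymplectic
          (NilSymp.TrivExt (NilSymp.nilradical (NilSymp.minimalParabolic b)) s),
      Nontrivial (NilSymp.EInfty (NilSymp.nilradical (NilSymp.minimalParabolic b)) 0 2),
      Nonempty (g ≃ₗ⁅ℂ⁆ LieAlgebra.SpecialLinear.sl (Fin 3) ℂ) ∨
        Nonempty (g ≃ₗ⁅ℂ⁆ LieAlgebra.Orthogonal.so (Fin 5) ℂ)] := by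
  classical
  obtain ⟨e⟩ := hg₀
  have : LieAlgebra.IsSimple ℝ g₀ := NilSymp.isSimple_of_baseChange e
  have : (LieAlgebra.IsKilling.rootSystem H).IsIrreducible := inferInstance
  have hφ := NilSymp.nilradicalIncl_injective (b := b)
  have hr := NilSymp.range_nilradicalIncl (b := b)
  have : LieRing.IsNilpotent (NilSymp.nilradical (NilSymp.minimalParabolic b)) :=
    NilSymp.isNilpotent_of_injective (b := b) _ hφ fun x => (hr _).mpr ⟨x, rfl⟩
  have h2 : 2 ≤ (Finset.univ.filter fun α => b.IsPos α).card := by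
    rwa [NilSymp.finrank_eq_card_isPos hφ hr] at hdim
  obtain ⟨k, hk⟩ := NilSymp.exists_nilIndex_eq hφ hr h2
  -- The roots live in the dual of H, so this is the rank plus the number of roots.
  have hg_dim : Module.finrank ℂ g = Module.finrank ℝ (Module.Dual ℝ H) +
      Fintype.card H.root := by
    rw [← e.toLinearEquiv.finrank_eq, Module.finrank_baseChange, NilSymp.finrank_eq_finrank_add_card H,
      Subspace.dual_finrank_eq]
  tfae_have 1 → 2 := by
    intro h
    rw [NilSymp.nontrivial_eInfty_iff hk]
    -- A single extension of even dimension suffices: s = 0 or s = 1 according to parity.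
    rcases Nat.even_or_odd (Module.finrank ℝ (NilSymp.nilradical (NilSymp.minimalParabolic b))) with hp | hp
    · exact NilSymp.exists_closed_of_isSymplectic_trivExt hk
        (h 0 (by rw [NilSymp.finrank_trivExt, zero_add]; exact hp))
    · exact NilSymp.exists_closed_of_isSymplectic_trivExt hk
        (h 1 (by rw [NilSymp.finrank_trivExt, add_comm]; exact hp.add_one))
  tfae_have 2 → 3 := by
    intro h
    rw [NilSymp.nontrivial_eInfty_iff hk] at h
    obtain ⟨ω, hω, z, hz, y, hzy⟩ := h
    obtain ⟨θ, hθ, hS⟩ := NilSymp.exists_top_card_le_two hφ hr hω (NilSymp.lie_eq_zero_of_mem_lcs hk hz) hzy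
    obtain ⟨β, β', hs⟩ := hθ.exists_hasUniqueSplitting h2 hS
    obtain ⟨hr2, hc⟩ := hθ.card_of_hasUniqueSplitting hs
    refine hg.sl_three_or_so_five ?_
    rw [hg_dim, hr2, NilSymp.card_eq_two_mul_card_isPos b]
    omega
  tfae_have 3 → 1 := by
    intro h s hs
    have hd : Module.finrank ℂ g = 8 ∨ Module.finrank ℂ g = 10 := by
      rcases h with ⟨⟨f⟩⟩ | ⟨⟨f⟩⟩
      · exact Or.inl (f.toLinearEquiv.finrank_eq.trans NilSymp.finrank_sl_three)
      · exact Or.inr (f.toLinearEquiv.finrank_eq.trans NilSymp.finrank_so_five)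
    obtain ⟨α, -⟩ := Finset.card_pos.mp (lt_of_lt_of_le two_pos h2)
    have : Nonempty H.root := ⟨α⟩
    obtain ⟨θ, hθ⟩ := NilSymp.exists_isTopRoot b
    rw [hg_dim] at hd
    obtain ⟨β, β', hsp⟩ := hθ.exists_hasUniqueSplitting_of_dim hd
    exact NilSymp.isSymplectic_trivExt_of_hasUniqueSplitting hφ hr hθ hsp hs
  tfae_finish
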